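/- **Conventions.** A rooted graph $(\mathcal G,e)$ is a non-oriented graph with vertex set $V$, edge set $E$ and a distinguished vertex $e$; loops and multiple edges are allowed. Let $n(x,y)$ be the number of edges connecting $x$ and $y$. The graph is uniformly locally finite if the degrees $\sum_y n(x,y)$ are bounded; its adjacency matrix is then the bounded operator $A(\mathcal G)$ on $\ell^2(V)$ with $A(\mathcal G)\delta(x)=\sum_y n(x,y)\delta(y)$. Put $\varphi_e(T)=\langle T\delta(e),\delta(e)\rangle$. The spectral distribution of $(\mathcal G,e)$ is the probability measure $\mu$ on $\mathbb R$ with $\int x^n\,d\mu=\varphi_e(A(\mathcal G)^n)$ for all $n\ge 0$; we identify it with the functional $X^n\mapsto\int x^n\,d\mu$ on $\mathbb C[X]$. The $\varphi$-distribution of a random variable $a$ is the functional $X^n\mapsto \varphi(a^n)$ on $\mathbb C[X]$. For a functional $\mu$ on $\mathbb C[X]$ with $\mu(1)=1$ put $\psi_\mu(z)=\sum_{n\ge1}\mu(X^n)z^n$; its first return moments $N_\mu(n)$ are defined by the formal power series $\eta_\mu=\psi_\mu/(1+\psi_\mu)=\sum_{n\ge1}N_\mu(n)z^n$, and $N_a(n)=N_\mu(n)$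 if $\mu$ is the distribution of $a$. Unital subalgebras $\mathcal A_1,\mathcal A_2$ are free with respect to $\varphi$ if $\varphi(a_1\cdots a_m)=0$ whenever $m\ge 1$, $a_k\in\mathcal A_{i_k}$, $\varphi(a_k)=0$ and $i_1\ne i_2\ne\dots\ne i_m$; two random variables are free if the unital algebras that they generate are. $\mu_1\boxtimes\mu_2$ is the distribution of $X_2X_1$ when $X_1,X_2$ are free with distributions $\mu_1,\mu_2$. For rooted graphs $(\mathcal G_1,e_1)$, $(\mathcal G_2,e_2)$ the vertices of the free product $\mathcal G_1*\mathcal G_2$ are the words $x_1x_2\cdots x_m$ ($m\ge0$) with letters in $(V_1\setminus\{e_1\})\sqcup(V_2\setminus\{e_2\})$ and neighbouring letters from different graphs; the root $e$ is the empty word. For $i\in\{1,2\}$ and every word $u$ not beginning with a letter from $V_i$, each edge of $\mathcal G_i$ with ends $x,y$ gives an edge of color $i$ with ends $xu,yu$, where $e_iu$ means $u$. A walk of length $m$ is a sequence $(v_0,\beta_1,v_1,\dots,\beta_m,v_m)$ with $\beta_k$ an edge connecting $v_{k-1}$ and $v_k$. It is alternating if consecutive edges have different colors. A walk of positive length from $v$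 to $v$ is an f-walk if it does not visit $v$ in between. $D_m(e)$ is the set of rooted alternating d-walks of length $m$, that is, alternating walks from $e$ to $e$ of length $m$ whose first edge has color $1$ and which are the concatenation of two f-walks from $e$ to $e$. **Theorem 9.2 (Multiplication Theorem for free independence).** Let $(\mathcal G_1,e_1)$ and $(\mathcal G_2,e_2)$ be uniformly locally finite rooted graphs with spectral distributions $\mu_1$ and $\mu_2$. Then $\mathcal G_1*\mathcal G_2$ is uniformly locally finite, and $A(\mathcal G_1*\mathcal G_2)=S_1+S_2$, where $S_i$ is the adjacency matrix of the subgraph formed by the edges of color $i$ (on all vertices of $\mathcal G_1*\mathcal G_2$). The pair $(S_1-1,S_2-1)$ is free with respect to $\varphi_e$. For every $n\ge1$ the set $D_{2n}(e)$ is finite, and, with $Z=S_2S_1$ and the state $\varphi_e$, $$N_Z(n)=N_{\mu_1\boxtimes\mu_2}(n)=|D_{2n}(e)|.$$ -/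

import Mathlib

open MeasureTheory
open scoped Polynomial PowerSeries lp CompactlySupported

namespace FreeMult

universe u

/-! ### Non-commutative probability -/

/-- The two colors (indices) of the index set `I = {1, 2}`. -/
inductive Color where
  | one
  | two
  deriving DecidableEq

/-- A normalized linear functional on a unital complex algebra; a pair of an algebra and such a
functional is a non-commutative probability space. -/
structure UnitalFunctional (A : Type u) [Ring A] [Algebra ℂ A] where
  toLinearMap : A →ₗ[ℂ] ℂ
  map_one' : toLinearMap 1 = 1

instance (A : Type u) [Ring A] [Algebra ℂ A] :
    CoeFun (UnitalFunctional A) (fun _ => A → ℂ) :=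
  ⟨fun φ => φ.toLinearMap⟩

theorem UnitalFunctional.ext {A : Type u} [Ring A] [Algebra ℂ A] {φ ψ : UnitalFunctional A}
    (h : ∀ a, φ a = ψ a) : φ = ψ := by
  rcases φ with ⟨f, hf⟩
  rcases ψ with ⟨g, hg⟩
  obtain rfl : f = g := LinearMap.ext h
  rfl

/-- Distributions: linear functionals on `ℂ[X]` that send `1` to `1`. -/
abbrev Distribution := UnitalFunctional ℂ[X]

/-- The `φ`-distribution of a random variable `a`: the functional `p ↦ φ (p(a))`. -/
noncomputable def UnitalFunctional.distribution {A : Type u} [Ring A] [Algebra ℂ A]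
    (φ : UnitalFunctional A) (a : A) : Distribution where
  toLinearMap := φ.toLinearMap ∘ₗ (Polynomial.aeval a).toLinearMap
  map_one' := by simpa using φ.map_one'

/-- The moment generating series `ψ_μ(z) = ∑_{n ≥ 1} μ(X ^ n) z ^ n`. -/
noncomputable def momentSeries (μ : Distribution) : ℂ⟦X⟧ :=
  PowerSeries.mk fun n => if n = 0 then 0 else μ (Polynomial.X ^ n)

/-- The first return moment series `η_μ = ψ_μ / (1 + ψ_μ)`. The series `1 + ψ_μ` has constant
coefficient `1`, so it is invertible and `⁻¹` is its genuine inverse. -/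
noncomputable def etaSeries (μ : Distribution) : ℂ⟦X⟧ :=
  momentSeries μ * (1 + momentSeries μ)⁻¹

/-- The `n`-th first return moment `N_μ(n)`, the coefficient of `z ^ n` in `η_μ`. -/
noncomputable def firstReturnMoment (μ : Distribution) (n : ℕ) : ℂ :=
  PowerSeries.coeff n (etaSeries μ)

/-- Free independence of two unital subalgebras with respect to `φ`: the functional vanishes on
`a₁ a₂ ⋯ aₙ` (`n ≥ 1`) whenever each `aₖ` lies in the subalgebra with index `iₖ`, `φ(aₖ) = 0`, and
neighbouring indices are different. A factor is recorded together with its index. -/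
def FreelyIndependent {A : Type u} [Ring A] [Algebra ℂ A] (φ : UnitalFunctional A)
    (B : Color → Subalgebra ℂ A) : Prop :=
  ∀ l : List (Color × A), l ≠ [] → l.IsChain (fun p q => p.1 ≠ q.1) →
    (∀ p ∈ l, p.2 ∈ B p.1 ∧ φ p.2 = 0) → φ (l.map Prod.snd).prod = 0

/-- `φ` is the free product of the distributions `μ₁` and `μ₂`: on the algebra `ℂ⟨X₁, X₂⟩`
of polynomials in two non-commuting variables, `Xᵢ` has distribution `μᵢ`, and `X₁`, `X₂` are
free. -/
def IsFreeProduct (μ : Color → Distribution) (φ : UnitalFunctional (FreeAlgebra ℂ Color)) : Prop :=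
  (∀ i, φ.distribution (FreeAlgebra.ι ℂ i) = μ i) ∧
    FreelyIndependent φ fun i => Algebra.adjoin ℂ {FreeAlgebra.ι ℂ i}

section FreeProductExistence

/-- The action of the variable `Xᵢ` on the free Fock space with basis the words in the letters
`(j, k)`, where `(j, k)` stands for the centered power `Xⱼ ^ (k + 1) - μⱼ(X ^ (k + 1))`. -/
noncomputable def fockBasis (μ : Color → Distribution) (i : Color) :
    List (Color × ℕ) → (List (Color × ℕ) →₀ ℂ)
  | [] => .single [(i, 0)] 1 + .single [] (μ i Polynomial.X)
  | (j, k) :: w =>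
    if j = i then
      .single ((i, k + 1) :: w) 1 + .single w (μ i (Polynomial.X ^ (k + 2)))
        - (μ i (Polynomial.X ^ (k + 1))) • (.single ((i, 0) :: w) 1 + .single w (μ i Polynomial.X))
    else .single ((i, 0) :: (j, k) :: w) 1 + .single ((j, k) :: w) (μ i Polynomial.X)

noncomputable def fockOp (μ : Color → Distribution) (i : Color) :
    Module.End ℂ (List (Color × ℕ) →₀ ℂ) :=
  Finsupp.linearCombination ℂ (fockBasis μ i)

def noHead (i : Color) : Set (List (Color × ℕ)) := {w | ∀ a ∈ w.head?, a.1 ≠ i}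

theorem fockOp_single (μ : Color → Distribution) {i : Color} {w : List (Color × ℕ)}
    (hw : w ∈ noHead i) : fockOp μ i (.single w 1) =
      .single ((i, 0) :: w) 1 + .single w (μ i Polynomial.X) := by
  rcases w with _ | ⟨⟨j, k⟩, w⟩
  · simp [fockOp, fockBasis]
  · have : j ≠ i := hw (j, k) (by simp)
    simp [fockOp, fockBasis, this]

theorem fockOp_cons (μ : Color → Distribution) {i : Color} {w : List (Color × ℕ)}
    (hw : w ∈ noHead i) (k : ℕ) : fockOp μ i (.single ((i, k) :: w) 1) =
      .single ((i, k + 1) :: w) 1 + .single w (μ i (Polynomial.X ^ (k + 2)))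
        - (μ i (Polynomial.X ^ (k + 1))) • fockOp μ i (.single w 1) := by
  rw [fockOp_single μ hw]
  simp [fockOp, fockBasis]

theorem fockOp_pow (μ : Color → Distribution) {i : Color} {w : List (Color × ℕ)}
    (hw : w ∈ noHead i) (n : ℕ) : (fockOp μ i ^ (n + 1)) (.single w 1) =
      .single ((i, n) :: w) 1 + .single w (μ i (Polynomial.X ^ (n + 1))) := by
  induction n with
  | zero => simp [fockOp_single μ hw]
  | succ n ih =>
    rw [pow_succ', Module.End.mul_apply, ih, map_add, fockOp_cons μ hw]
    have : (Finsupp.single w (μ i (Polynomial.X ^ (n + 1))) : List (Color × ℕ) →₀ ℂ) =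
      (μ i (Polynomial.X ^ (n + 1))) • .single w 1 := by simp
    rw [this, map_smul]
    abel

theorem fockOp_aeval (μ : Color → Distribution) {i : Color} {w : List (Color × ℕ)}
    (hw : w ∈ noHead i) (p : ℂ[X]) : ∃ f ∈ Finsupp.supported ℂ ℂ (noHead i)ᶜ,
      Polynomial.aeval (fockOp μ i) p (.single w 1) = f + μ i p • .single w 1 := by
  induction p using Polynomial.induction_on' with
  | add p q hp hq =>
    obtain ⟨f, hf, hf'⟩ := hp
    obtain ⟨g, hg, hg'⟩ := hq
    refine ⟨f + g, add_mem hf hg, ?_⟩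
    rw [map_add, LinearMap.add_apply, hf', hg', map_add, add_smul]
    abel
  | monomial n a =>
    rcases n with _ | n
    · refine ⟨0, zero_mem _, ?_⟩
      have : (μ i).toLinearMap (Polynomial.C a) = a := by
        have h := (μ i).toLinearMap.map_smul a 1
        rw [(μ i).map_one'] at h
        simpa [Polynomial.smul_eq_C_mul] using h
      rw [Polynomial.monomial_zero_left, Polynomial.aeval_C, this]
      simp [Module.algebraMap_end_apply]
    · refine ⟨a • .single ((i, n) :: w) 1, Submodule.smul_mem _ _ ?_, ?_⟩
      · exact Finsupp.single_mem_supported ℂ _ (by simp [noHead])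
      · rw [Polynomial.aeval_monomial, Module.End.mul_apply, fockOp_pow μ hw,
          ← Polynomial.C_mul_X_pow_eq_monomial, ← Polynomial.smul_eq_C_mul, map_smul,
          Module.algebraMap_end_apply, smul_add]
        simp

noncomputable def fockRep (μ : Color → Distribution) :
    FreeAlgebra ℂ Color →ₐ[ℂ] Module.End ℂ (List (Color × ℕ) →₀ ℂ) :=
  FreeAlgebra.lift ℂ (fockOp μ)

noncomputable def fockState (μ : Color → Distribution) :
    UnitalFunctional (FreeAlgebra ℂ Color) where
  toLinearMap := Finsupp.lapply [] ∘ₗ LinearMap.applyₗ (.single [] 1) ∘ₗ (fockRep μ).toLinearMap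
  map_one' := by simp

theorem fockState_apply (μ : Color → Distribution) (a : FreeAlgebra ℂ Color) :
    fockState μ a = fockRep μ a (.single [] 1) [] := rfl

theorem fockRep_aeval (μ : Color → Distribution) (i : Color) (p : ℂ[X]) :
    fockRep μ (Polynomial.aeval (FreeAlgebra.ι ℂ i) p) = Polynomial.aeval (fockOp μ i) p := by
  rw [← Polynomial.aeval_algHom_apply]
  simp [fockRep]

theorem fockState_aeval (μ : Color → Distribution) (i : Color) (p : ℂ[X]) :
    fockState μ (Polynomial.aeval (FreeAlgebra.ι ℂ i) p) = μ i p := by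
  obtain ⟨f, hf, h⟩ := fockOp_aeval μ (i := i) (w := []) (by simp [noHead]) p
  have h0 : f [] = 0 := by
    by_contra h0
    exact hf (by simpa using h0) (by simp [noHead])
  rw [fockState_apply, fockRep_aeval, h]
  simp [h0]

theorem fockRep_chain (μ : Color → Distribution) (i : Color)
    (l : List (Color × FreeAlgebra ℂ Color)) (hl : (l.map Prod.fst).head? ≠ some i)
    (hc : l.IsChain (fun p q => p.1 ≠ q.1))
    (h : ∀ p ∈ l, p.2 ∈ Algebra.adjoin ℂ {FreeAlgebra.ι ℂ p.1} ∧ fockState μ p.2 = 0) :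
    fockRep μ (l.map Prod.snd).prod (.single [] 1) ∈ Finsupp.supported ℂ ℂ (noHead i) ∧
      (l ≠ [] → fockState μ (l.map Prod.snd).prod = 0) := by
  induction l generalizing i with
  | nil =>
    refine ⟨?_, fun h => absurd rfl h⟩
    simpa using Finsupp.single_mem_supported ℂ (1 : ℂ) (a := ([] : List (Color × ℕ)))
      (s := noHead i) (by simp [noHead])
  | cons q l ih =>
    obtain ⟨j, a⟩ := q
    have hji : j ≠ i := by simpa using hl
    have hj : (l.map Prod.fst).head? ≠ some j := by
      rcases l with _ | ⟨r, l⟩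
      · simp
      · have := (List.isChain_cons_cons.1 hc).1
        simpa using this.symm
    obtain ⟨h1, -⟩ := ih j hj hc.tail (fun p hp => h p (List.mem_cons_of_mem _ hp))
    obtain ⟨ha, ha0⟩ := h (j, a) (by simp)
    rw [Algebra.adjoin_singleton_eq_range_aeval] at ha
    obtain ⟨p, hpa⟩ := ha
    replace hpa : Polynomial.aeval (FreeAlgebra.ι ℂ j) p = a := hpa
    subst hpa
    have hp : μ j p = 0 := by rw [← fockState_aeval μ j p]; exact ha0
    have key : ∀ f ∈ Finsupp.supported ℂ ℂ (noHead j),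
        Polynomial.aeval (fockOp μ j) p f ∈ Finsupp.supported ℂ ℂ (noHead j)ᶜ := by
      intro f hf
      rw [Finsupp.supported_eq_span_single] at hf
      refine Submodule.span_induction ?_ (by simp) (fun x y _ _ hx hy => ?_)
        (fun c x _ hx => ?_) hf
      · rintro _ ⟨w, hw, rfl⟩
        obtain ⟨f, hf, h⟩ := fockOp_aeval μ hw p
        rw [h, hp, zero_smul, add_zero]
        exact hf
      · rw [map_add]; exact add_mem hx hy
      · rw [map_smul]; exact Submodule.smul_mem _ _ hx
    have h2 := key _ h1
    have h3 : fockRep μ ((((j, Polynomial.aeval (FreeAlgebra.ι ℂ j) p) : Color × _) :: l).map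
        Prod.snd).prod (.single [] 1) ∈ Finsupp.supported ℂ ℂ (noHead j)ᶜ := by
      rw [List.map_cons, List.prod_cons, map_mul, Module.End.mul_apply, fockRep_aeval]
      exact h2
    refine ⟨Finsupp.supported_mono ?_ h3, fun _ => ?_⟩
    · intro w hw
      simp only [noHead, Set.mem_compl_iff, Set.mem_ofPred_eq, not_forall] at hw ⊢
      obtain ⟨b, hb, hbj⟩ := hw
      intro c hc
      rw [Option.mem_def] at hb hc
      rw [hb] at hc
      obtain rfl := Option.some.inj hc
      rw [not_not.1 hbj]
      exact hji
    · by_contra h0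
      exact h3 (by simpa [fockState_apply] using h0) (by simp [noHead])

theorem exists_isFreeProduct (μ : Color → Distribution) : ∃ φ, IsFreeProduct μ φ := by
  refine ⟨fockState μ, fun i => ?_, fun l hl hc h => ?_⟩
  · exact UnitalFunctional.ext fun p => fockState_aeval μ i p
  · obtain ⟨i, hi⟩ : ∃ i, (l.map Prod.fst).head? ≠ some i := by
      rcases h : (l.map Prod.fst).head? with _ | c
      · exact ⟨.one, by simp⟩
      · rcases c with _ | _
        · exact ⟨.two, by simp⟩
        · exact ⟨.one, by simp⟩
    exact (fockRep_chain μ i l hi hc h).2 hl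

/-- The product of centered powers `Xᵢ ^ (k + 1) - μᵢ(X ^ (k + 1))` along a word of pairs `(i, k)`. -/
noncomputable def centeredWord (μ : Color → Distribution) (w : List (Color × ℕ)) :
    FreeAlgebra ℂ Color :=
  (w.map fun p => FreeAlgebra.ι ℂ p.1 ^ (p.2 + 1) -
    algebraMap ℂ _ (μ p.1 (Polynomial.X ^ (p.2 + 1)))).prod

theorem span_centeredWord (μ : Color → Distribution) :
    Submodule.span ℂ (centeredWord μ '' {w | w.IsChain (fun p q => p.1 ≠ q.1)}) = ⊤ := by
  set M := Submodule.span ℂ (centeredWord μ '' {w | w.IsChain (fun p q => p.1 ≠ q.1)}) with hM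
  have hmem : ∀ w : List (Color × ℕ), w.IsChain (fun p q => p.1 ≠ q.1) → centeredWord μ w ∈ M :=
    fun w hw => Submodule.subset_span ⟨w, hw, rfl⟩
  have hfree : ∀ i (w : List (Color × ℕ)), w.IsChain (fun p q => p.1 ≠ q.1) →
      (∀ a ∈ w.head?, a.1 ≠ i) → FreeAlgebra.ι ℂ i * centeredWord μ w ∈ M := by
    intro i w hw hi
    have hw' : ((i, 0) :: w).IsChain (fun p q => p.1 ≠ q.1) := by
      rcases w with _ | ⟨a, w⟩
      · simp
      · exact List.isChain_cons_cons.2 ⟨(hi a (by simp)).symm, hw⟩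
    have : FreeAlgebra.ι ℂ i * centeredWord μ w =
        centeredWord μ ((i, 0) :: w) + μ i Polynomial.X • centeredWord μ w := by
      simp [centeredWord, Algebra.smul_def, sub_mul]
    rw [this]
    exact add_mem (hmem _ hw') (M.smul_mem _ (hmem _ hw))
  have hι : ∀ i, ∀ x ∈ M, FreeAlgebra.ι ℂ i * x ∈ M := by
    intro i x hx
    refine Submodule.span_induction ?_ (by simp) (fun x y _ _ hx hy => ?_)
      (fun c x _ hx => ?_) hx
    · rintro _ ⟨w, hw, rfl⟩
      by_cases hi : ∀ a ∈ w.head?, a.1 ≠ i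
      · exact hfree i w hw hi
      · rcases w with _ | ⟨⟨j, k⟩, w⟩
        · simp at hi
        · have hji : j = i := by simpa using hi
          subst hji
          have hw' : ((j, k + 1) :: w).IsChain (fun p q => p.1 ≠ q.1) := by
            rcases w with _ | ⟨a, w⟩
            · simp
            · exact List.isChain_cons_cons.2 (List.isChain_cons_cons.1 hw)
          have hj : ∀ a ∈ w.head?, a.1 ≠ j := by
            rcases w with _ | ⟨a, w⟩
            · simp
            · simpa using (List.isChain_cons_cons.1 hw).1.symm
          have : FreeAlgebra.ι ℂ j * centeredWord μ ((j, k) :: w) =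
              centeredWord μ ((j, k + 1) :: w) +
                μ j (Polynomial.X ^ (k + 2)) • centeredWord μ w -
                μ j (Polynomial.X ^ (k + 1)) • (FreeAlgebra.ι ℂ j * centeredWord μ w) := by
            simp only [centeredWord, List.map_cons, List.prod_cons, Algebra.algebraMap_eq_smul_one]
            simp only [sub_mul, mul_sub, smul_mul_assoc, mul_smul_comm, one_mul,
              pow_succ' _ (k + 1), mul_assoc]
            abel
          rw [this]
          exact sub_mem (add_mem (hmem _ hw') (M.smul_mem _ (hmem _ hw.tail)))
            (M.smul_mem _ (hfree j w hw.tail hj))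
    · rw [mul_add]; exact add_mem hx hy
    · rw [mul_smul_comm]; exact M.smul_mem _ hx
  have hall : ∀ a : FreeAlgebra ℂ Color, ∀ x ∈ M, a * x ∈ M := by
    intro a
    induction a using FreeAlgebra.induction with
    | grade0 r => intro x hx; rw [← Algebra.smul_def]; exact M.smul_mem _ hx
    | grade1 i => exact hι i
    | mul a b ha hb => intro x hx; rw [mul_assoc]; exact ha _ (hb _ hx)
    | add a b ha hb => intro x hx; rw [add_mul]; exact add_mem (ha _ hx) (hb _ hx)
  refine Submodule.eq_top_iff'.2 fun a => ?_
  have h1 : (1 : FreeAlgebra ℂ Color) ∈ M := by simpa [centeredWord] using hmem [] (by simp)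
  simpa using hall a 1 h1

theorem IsFreeProduct.apply_centeredWord {μ : Color → Distribution}
    {φ : UnitalFunctional (FreeAlgebra ℂ Color)} (hφ : IsFreeProduct μ φ) {w : List (Color × ℕ)}
    (hw : w.IsChain (fun p q => p.1 ≠ q.1)) (h0 : w ≠ []) : φ (centeredWord μ w) = 0 := by
  have h := hφ.2 (w.map fun p => (p.1, FreeAlgebra.ι ℂ p.1 ^ (p.2 + 1) -
    algebraMap ℂ _ (μ p.1 (Polynomial.X ^ (p.2 + 1))))) (by simpa using h0)
    ((List.isChain_map _).2 hw) ?_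
  · rwa [List.map_map] at h
  · intro p hp
    obtain ⟨⟨i, k⟩, -, rfl⟩ := List.mem_map.1 hp
    refine ⟨sub_mem (pow_mem (Algebra.self_mem_adjoin_singleton ℂ _) _)
      (Subalgebra.algebraMap_mem _ _), ?_⟩
    have hd : φ (FreeAlgebra.ι ℂ i ^ (k + 1)) = μ i (Polynomial.X ^ (k + 1)) := by
      rw [← hφ.1 i]
      simp [UnitalFunctional.distribution]
    simp only [map_sub, hd, Algebra.algebraMap_eq_smul_one, map_smul, φ.map_one']
    simp

end FreeProductExistence

/-- The free product of two distributions exists and is unique. -/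
theorem existsUnique_isFreeProduct (μ : Color → Distribution) : ∃! φ, IsFreeProduct μ φ := by
  obtain ⟨φ, hφ⟩ := exists_isFreeProduct μ
  refine ⟨φ, hφ, fun ψ hψ => UnitalFunctional.ext fun a => ?_⟩
  have ha : a ∈ Submodule.span ℂ (centeredWord μ '' {w | w.IsChain (fun p q => p.1 ≠ q.1)}) := by
    rw [span_centeredWord]; trivial
  refine LinearMap.eqOn_span (f := ψ.toLinearMap) (g := φ.toLinearMap) ?_ ha
  rintro _ ⟨w, hw, rfl⟩
  by_cases h0 : w = []
  · subst h0
    simpa [centeredWord] using ψ.map_one'.trans φ.map_one'.symm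
  · exact (hψ.apply_centeredWord hw h0).trans (hφ.apply_centeredWord hw h0).symm

/-- The functional on `ℂ⟨X₁, X₂⟩` for which `X₁`, `X₂` are free with distributions `μ₁`, `μ₂`. -/
noncomputable def freeProductFunctional (μ : Color → Distribution) :
    UnitalFunctional (FreeAlgebra ℂ Color) :=
  (exists_isFreeProduct μ).choose

theorem isFreeProduct_freeProductFunctional (μ : Color → Distribution) :
    IsFreeProduct μ (freeProductFunctional μ) :=
  (exists_isFreeProduct μ).choose_spec

/-- The free multiplicative convolution `μ₁ ⊠ μ₂`: the distribution of `X₂ X₁`, where `X₁` and `X₂`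
are free random variables with distributions `μ₁` and `μ₂`. -/
noncomputable def freeMulConv (μ₁ μ₂ : Distribution) : Distribution :=
  (freeProductFunctional fun | .one => μ₁ | .two => μ₂).distribution
    (FreeAlgebra.ι ℂ Color.two * FreeAlgebra.ι ℂ Color.one)

/-- A bounded self-adjoint operator has a spectral distribution in every vector state. -/
theorem exists_spectralMeasure {H : Type u} [NormedAddCommGroup H] [InnerProductSpace ℂ H]
    [CompleteSpace H] (T : H →L[ℂ] H) (hsa : IsSelfAdjoint T) (ξ : H) (hξ : ‖ξ‖ = 1) :
    ∃ μ : ProbabilityMeasure ℝ, ∀ n : ℕ, Integrable (fun x : ℝ => x ^ n) (μ : Measure ℝ) ∧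
      inner ℂ ξ ((T ^ n) ξ) = ((∫ x : ℝ, x ^ n ∂(μ : Measure ℝ) : ℝ) : ℂ) := by
  let Λ : C_c(spectrum ℝ T, ℝ) →ₗ[ℝ] ℝ :=
    { toFun := fun f => (inner ℂ ξ (cfcHom hsa (f : C(spectrum ℝ T, ℝ)) ξ)).re
      map_add' := fun f g => by
        have : ((f + g : C_c(spectrum ℝ T, ℝ)) : C(spectrum ℝ T, ℝ)) = f + g := rfl
        rw [this, map_add]
        simp
      map_smul' := fun c f => by
        have : ((c • f : C_c(spectrum ℝ T, ℝ)) : C(spectrum ℝ T, ℝ)) = c • f := rfl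
        rw [this, map_smul, smul_apply, inner_smul_right_eq_smul]
        simp }
  have hΛ : ∀ f, 0 ≤ f → 0 ≤ Λ f := by
    intro f hf
    have h1 : 0 ≤ cfcHom hsa (f : C(spectrum ℝ T, ℝ)) := (cfcHom_nonneg_iff hsa).2 hf
    rw [ContinuousLinearMap.nonneg_iff_isPositive] at h1
    exact h1.re_inner_nonneg_right ξ
  let Λ' : C_c(spectrum ℝ T, ℝ) →ₚ[ℝ] ℝ := PositiveLinearMap.mk₀ Λ hΛ
  have hrep := RealRMK.integral_rieszMeasure Λ'
  set ν := RealRMK.rieszMeasure Λ' with hν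
  have hmom : ∀ n : ℕ, ∫ x : spectrum ℝ T, (x : ℝ) ^ n ∂ν = (inner ℂ ξ ((T ^ n) ξ)).re := by
    intro n
    let g : C(spectrum ℝ T, ℝ) := (ContinuousMap.restrict (spectrum ℝ T) (.id ℝ)) ^ n
    have h1 := hrep (CompactlySupportedContinuousMap.continuousMapEquiv g)
    have h2 : cfcHom hsa g = T ^ n := by
      rw [map_pow, cfcHom_id]
    rw [← h2]
    exact h1
  have hreal : ∀ n : ℕ, inner ℂ ξ ((T ^ n) ξ) = (((inner ℂ ξ ((T ^ n) ξ)).re : ℝ) : ℂ) := by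
    intro n
    refine (Complex.conj_eq_iff_re.1 ?_).symm
    rw [inner_conj_symm, ← ContinuousLinearMap.adjoint_inner_right]
    rw [ContinuousLinearMap.isSelfAdjoint_iff'.1 (hsa.pow n)]
  have hemb : MeasurableEmbedding (Subtype.val : spectrum ℝ T → ℝ) :=
    MeasurableEmbedding.subtype_coe (spectrum.isCompact T).isClosed.measurableSet
  have hprob : IsProbabilityMeasure ν := by
    have h := hmom 0
    have h1 : (inner ℂ ξ ((T ^ 0) ξ)).re = 1 := by
      rw [pow_zero, one_apply_eq_self, inner_self_eq_norm_sq_to_K, hξ]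
      simp
    rw [h1] at h
    simp only [pow_zero, integral_const, smul_eq_mul, mul_one] at h
    rw [isProbabilityMeasure_iff]
    rw [Measure.real, ENNReal.toReal_eq_one_iff] at h
    exact h
  refine ⟨⟨ν.map Subtype.val, Measure.isProbabilityMeasure_map
    hemb.measurable.aemeasurable⟩, fun n => ⟨?_, ?_⟩⟩
  · change Integrable (fun x : ℝ => x ^ n) (ν.map Subtype.val)
    rw [hemb.integrable_map_iff]
    have hc : Continuous ((fun x : ℝ => x ^ n) ∘ (Subtype.val : spectrum ℝ T → ℝ)) := by
      fun_prop
    exact hc.integrable_of_hasCompactSupport (HasCompactSupport.of_compactSpace _)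
  · change _ = ((∫ x : ℝ, x ^ n ∂(ν.map Subtype.val) : ℝ) : ℂ)
    rw [hemb.integral_map, hmom n]
    exact hreal n

/-- The distribution (moment functional) `ℂ[X] → ℂ`, `X ^ n ↦ ∫ x ^ n dμ`, of a probability measure
on the line; it is meant for measures with finite moments. -/
noncomputable def measureDistribution (μ : ProbabilityMeasure ℝ) : Distribution where
  toLinearMap := (Polynomial.basisMonomials ℂ).constr ℂ
    fun n => ((∫ x : ℝ, x ^ n ∂(μ : Measure ℝ) : ℝ) : ℂ)
  map_one' := by
    have h : (1 : ℂ[X]) = Polynomial.basisMonomials ℂ 0 := by simp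
    rw [h, Module.Basis.constr_basis]
    simp

/-! ### Rooted graphs and their adjacency operators -/

/-- A rooted non-oriented graph with vertex set `V` and edge set `E`; loops and multiple edges are
allowed. `ends β` is the unordered pair of end vertices of the edge `β`. -/
structure RootedGraph where
  V : Type u
  E : Type u
  ends : E → Sym2 V
  root : V

namespace RootedGraph

/-- The number `n(x, y)` of edges connecting `x` and `y`. -/
noncomputable def edgeCount (G : RootedGraph.{u}) (x y : G.V) : ℕ :=
  Nat.card {β : G.E // G.ends β = s(x, y)}

/-- The degree of `x`: the number `∑_y n(x, y)` of edges incident on `x`, a loop being counted once. -/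
noncomputable def degree (G : RootedGraph.{u}) (x : G.V) : ℕ∞ :=
  {β : G.E | x ∈ G.ends β}.encard

/-- The degrees of the vertices are bounded. -/
def UniformlyLocallyFinite (G : RootedGraph.{u}) : Prop :=
  ∃ K : ℕ, ∀ x, G.degree x ≤ K

open Classical in
/-- The vector `δ(x)` of the standard orthonormal basis of `ℓ²(V)`. -/
noncomputable def delta (G : RootedGraph.{u}) (x : G.V) : ℓ²(G.V, ℂ) :=
  lp.single 2 x (1 : ℂ)

/-- `T δ(x) = ∑_y n(x, y) δ(y)` for every vertex `x`. -/
def IsAdjacencyOperator (G : RootedGraph.{u}) (T : ℓ²(G.V, ℂ) →L[ℂ] ℓ²(G.V, ℂ)) : Prop :=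
  ∀ x y, T (G.delta x) y = G.edgeCount x y

open Classical in
/-- The adjacency matrix `A(𝒢)` as the bounded operator on `ℓ²(V)` with
`A δ(x) = ∑_y n(x, y) δ(y)`. It is used for uniformly locally finite graphs only, for which it
exists by `isAdjacencyOperator_adjacencyOperator` below (otherwise the value is `0`). -/
noncomputable def adjacencyOperator (G : RootedGraph.{u}) : ℓ²(G.V, ℂ) →L[ℂ] ℓ²(G.V, ℂ) :=
  if h : ∃ T, G.IsAdjacencyOperator T then h.choose else 0

theorem edgeCount_comm (G : RootedGraph.{u}) (x y : G.V) :
    G.edgeCount x y = G.edgeCount y x := by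
  rw [edgeCount, edgeCount, Sym2.eq_swap]

theorem sum_edgeCount_le (G : RootedGraph.{u}) {K : ℕ} (hK : ∀ x, G.degree x ≤ K) (x : G.V)
    (t : Finset G.V) : ∑ y ∈ t, G.edgeCount x y ≤ K := by
  classical
  have hfin : {β : G.E | x ∈ G.ends β}.Finite :=
    Set.finite_of_encard_le_coe (hK x)
  set F := hfin.toFinset with hF
  have hcard : F.card ≤ K := by
    have := hK x
    rw [degree, hfin.encard_eq_coe_toFinset_card] at this
    exact_mod_cast this
  have h1 : ∀ y, G.edgeCount x y = (F.filter fun β => G.ends β = s(x, y)).card := by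
    intro y
    rw [edgeCount]
    refine Nat.subtype_card _ fun β => ?_
    simp only [hF, Finset.mem_filter, Set.Finite.mem_toFinset, Set.mem_ofPred_eq]
    exact ⟨fun h => h.2, fun h => ⟨by rw [h]; exact Sym2.mem_mk_left x y, h⟩⟩
  calc ∑ y ∈ t, G.edgeCount x y = ∑ y ∈ t, (F.filter fun β => G.ends β = s(x, y)).card :=
        Finset.sum_congr rfl fun y _ => h1 y
    _ = (t.biUnion fun y => F.filter fun β => G.ends β = s(x, y)).card := by
        rw [Finset.card_biUnion]
        intro y _ z _ hyz
        rw [Function.onFun, Finset.disjoint_left]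
        intro β hβ hβ'
        rw [Finset.mem_filter] at hβ hβ'
        have := hβ.2.symm.trans hβ'.2
        exact hyz (Sym2.congr_right.1 this)
    _ ≤ F.card := Finset.card_le_card (by
        intro β hβ
        simp only [Finset.mem_biUnion, Finset.mem_filter] at hβ
        exact hβ.choose_spec.2.1)
    _ ≤ K := hcard

theorem exists_isAdjacencyOperator (G : RootedGraph.{u}) (hG : G.UniformlyLocallyFinite) :
    ∃ T, G.IsAdjacencyOperator T := by
  classical
  obtain ⟨K, hK⟩ := hG
  have hsum := G.sum_edgeCount_le hK
  have hN : ∀ x, {y | G.edgeCount x y ≠ 0}.Finite := by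
    intro x
    by_contra hinf
    obtain ⟨t, ht, htc⟩ := Set.Infinite.exists_subset_card_eq hinf (K + 1)
    have h1 := hsum x t
    have h2 : t.card • 1 ≤ ∑ y ∈ t, G.edgeCount x y :=
      Finset.card_nsmul_le_sum _ _ _ fun y hy => Nat.one_le_iff_ne_zero.2 (ht hy)
    simp at h2
    omega
  let N : G.V → Finset G.V := fun x => (hN x).toFinset
  have hNmem : ∀ x y, y ∉ N x → G.edgeCount x y = 0 := by
    intro x y h
    simpa [N] using h
  let S : (G.V → ℂ) → G.V → ℂ := fun f x => ∑ y ∈ N x, (G.edgeCount x y : ℂ) * f y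
  have bound : ∀ (f : ℓ²(G.V, ℂ)) (s : Finset G.V),
      ∑ x ∈ s, ‖S f x‖ ^ 2 ≤ (K * ‖f‖) ^ 2 := by
    intro f s
    let t := s.biUnion N
    have hf2 : ∑ y ∈ t, ‖f y‖ ^ 2 ≤ ‖f‖ ^ 2 := by
      have := lp.sum_rpow_le_norm_rpow (p := 2) (by norm_num) f t
      simpa using this
    have h1 : ∀ x ∈ s, ‖S f x‖ ^ 2 ≤ K * ∑ y ∈ t, (G.edgeCount x y : ℝ) * ‖f y‖ ^ 2 := by
      intro x hx
      have hsub : N x ⊆ t := Finset.subset_biUnion_of_mem N hx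
      have e1 : ‖S f x‖ ≤ ∑ y ∈ t, (G.edgeCount x y : ℝ) * ‖f y‖ := by
        refine (norm_sum_le _ _).trans ?_
        simp only [norm_mul, Complex.norm_natCast]
        exact Finset.sum_le_sum_of_subset_of_nonneg hsub fun _ _ _ => by positivity
      have e2 : (∑ y ∈ t, (G.edgeCount x y : ℝ) * ‖f y‖) ^ 2 ≤
          (∑ y ∈ t, (G.edgeCount x y : ℝ)) * ∑ y ∈ t, (G.edgeCount x y : ℝ) * ‖f y‖ ^ 2 :=
        Finset.sum_sq_le_sum_mul_sum_of_sq_le_mul _ (fun _ _ => by positivity)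
          (fun _ _ => by positivity) fun _ _ => le_of_eq (by ring)
      calc ‖S f x‖ ^ 2 ≤ (∑ y ∈ t, (G.edgeCount x y : ℝ) * ‖f y‖) ^ 2 := by gcongr
        _ ≤ _ := e2
        _ ≤ _ := by
          gcongr
          exact_mod_cast hsum x t
    calc ∑ x ∈ s, ‖S f x‖ ^ 2
        ≤ ∑ x ∈ s, K * ∑ y ∈ t, (G.edgeCount x y : ℝ) * ‖f y‖ ^ 2 := Finset.sum_le_sum h1
      _ = K * ∑ y ∈ t, (∑ x ∈ s, (G.edgeCount x y : ℝ)) * ‖f y‖ ^ 2 := by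
        rw [← Finset.mul_sum, Finset.sum_comm]
        simp_rw [Finset.sum_mul]
      _ ≤ K * ∑ y ∈ t, (K : ℝ) * ‖f y‖ ^ 2 := by
        gcongr with y hy
        simp_rw [G.edgeCount_comm _ y]
        exact_mod_cast hsum y s
      _ ≤ (K * ‖f‖) ^ 2 := by
        rw [← Finset.mul_sum, mul_pow]
        nlinarith [hf2, (by positivity : (0 : ℝ) ≤ (K : ℝ) ^ 2)]
  have bound' : ∀ (f : ℓ²(G.V, ℂ)) (s : Finset G.V),
      ∑ x ∈ s, ‖S f x‖ ^ (2 : ENNReal).toReal ≤ (K * ‖f‖) ^ (2 : ENNReal).toReal := by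
    intro f s
    simpa using bound f s
  let L : ℓ²(G.V, ℂ) →ₗ[ℂ] ℓ²(G.V, ℂ) :=
    { toFun := fun f => ⟨S f, memℓp_gen' (bound' f)⟩
      map_add' := fun f g => by
        ext x
        change S _ x = S f x + S g x
        simp [S, mul_add, Finset.sum_add_distrib]
      map_smul' := fun c f => by
        ext x
        change S _ x = c • S f x
        simp [S, Finset.mul_sum, mul_left_comm] }
  refine ⟨L.mkContinuous K fun f => ?_, fun x y => ?_⟩
  · exact lp.norm_le_of_forall_sum_le (by norm_num) (by positivity) (bound' f)
  · have : L (G.delta x) y = ∑ z ∈ N y, (G.edgeCount y z : ℂ) * G.delta x z := rfl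
    rw [LinearMap.mkContinuous_apply, this, G.edgeCount_comm x y]
    simp only [delta, lp.single_apply, Pi.single_apply, mul_ite, mul_one, mul_zero,
      Finset.sum_ite_eq']
    split_ifs with h
    · rfl
    · rw [hNmem y x h, Nat.cast_zero]

theorem isAdjacencyOperator_adjacencyOperator (G : RootedGraph.{u})
    (hG : G.UniformlyLocallyFinite) : G.IsAdjacencyOperator G.adjacencyOperator := by
  have h := G.exists_isAdjacencyOperator hG
  rw [adjacencyOperator, dif_pos h]
  exact h.choose_spec

theorem norm_delta (G : RootedGraph.{u}) (x : G.V) : ‖G.delta x‖ = 1 := by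
  classical
  rw [delta, lp.norm_single (by norm_num)]
  simp

theorem inner_delta_left (G : RootedGraph.{u}) (x : G.V) (f : ℓ²(G.V, ℂ)) :
    inner ℂ (G.delta x) f = f x := by
  classical
  rw [delta, lp.inner_single_left]
  simp

/-- The state `φ_e(T) = ⟨T δ(e), δ(e)⟩` associated with the root, on the bounded operators. -/
noncomputable def rootState (G : RootedGraph.{u}) :
    UnitalFunctional (ℓ²(G.V, ℂ) →L[ℂ] ℓ²(G.V, ℂ)) where
  toLinearMap :=
    { toFun := fun T => inner ℂ (G.delta G.root) (T (G.delta G.root))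
      map_add' := fun S T => by simp
      map_smul' := fun c T => by simp }
  map_one' := by
    change inner ℂ (G.delta G.root) (G.delta G.root) = 1
    rw [inner_self_eq_norm_sq_to_K, norm_delta]
    simp

/-- `μ` is the spectral distribution of the rooted graph: its moments are those of the
adjacency operator in the state `φ_e`. -/
def IsSpectralDistribution (G : RootedGraph.{u}) (μ : ProbabilityMeasure ℝ) : Prop :=
  ∀ n : ℕ, Integrable (fun x : ℝ => x ^ n) (μ : Measure ℝ) ∧
    G.rootState (G.adjacencyOperator ^ n) = ((∫ x : ℝ, x ^ n ∂(μ : Measure ℝ) : ℝ) : ℂ)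

theorem isSelfAdjoint_adjacencyOperator (G : RootedGraph.{u}) :
    IsSelfAdjoint G.adjacencyOperator := by
  classical
  by_cases h : ∃ T, G.IsAdjacencyOperator T
  · have hT : G.IsAdjacencyOperator G.adjacencyOperator := by
      rw [adjacencyOperator, dif_pos h]
      exact h.choose_spec
    set T := G.adjacencyOperator
    have hd : ∀ x, T (G.delta x) = ContinuousLinearMap.adjoint T (G.delta x) := by
      intro x
      ext y
      rw [← inner_delta_left, ← inner_delta_left, ContinuousLinearMap.adjoint_inner_right,
        inner_delta_left, ← inner_conj_symm, inner_delta_left, hT, hT, G.edgeCount_comm]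
      simp
    rw [ContinuousLinearMap.isSelfAdjoint_iff']
    refine ContinuousLinearMap.ext fun f => ?_
    have hf := lp.hasSum_single (p := 2) (by norm_num) f
    have hs : ∀ x, lp.single 2 x (f x) = f x • G.delta x := by
      intro x
      rw [delta, ← lp.single_smul]
      simp
    refine (hf.mapL (ContinuousLinearMap.adjoint T)).unique ?_
    convert hf.mapL T using 2 with x
    rw [hs, map_smul, map_smul, hd]
  · rw [adjacencyOperator, dif_neg h]
    exact IsSelfAdjoint.zero _

theorem exists_isSpectralDistribution (G : RootedGraph.{u}) :
    ∃ μ : ProbabilityMeasure ℝ, G.IsSpectralDistribution μ :=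
  exists_spectralMeasure G.adjacencyOperator G.isSelfAdjoint_adjacencyOperator
    (G.delta G.root) (G.norm_delta G.root)

/-- The spectral distribution of the rooted graph. -/
noncomputable def spectralDistribution (G : RootedGraph.{u}) : ProbabilityMeasure ℝ :=
  G.exists_isSpectralDistribution.choose

theorem isSpectralDistribution_spectralDistribution (G : RootedGraph.{u}) :
    G.IsSpectralDistribution G.spectralDistribution :=
  G.exists_isSpectralDistribution.choose_spec

/-- The graph with the same vertices and root whose edges are the edges of color `i`. -/
def monochromatic (G : RootedGraph.{u}) (c : G.E → Color) (i : Color) : RootedGraph.{u} where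
  V := G.V
  E := {β : G.E // c β = i}
  ends := fun β => G.ends β
  root := G.root

/-! ### Walks -/

/-- A walk `(v₀, β₁, v₁, …, βₙ, vₙ)` of length `n`. -/
structure Walk (G : RootedGraph.{u}) (n : ℕ) where
  vert : Fin (n + 1) → G.V
  edge : Fin n → G.E
  ends_edge : ∀ i : Fin n, G.ends (edge i) = s(vert i.castSucc, vert i.succ)

/-- The subwalk of `w` from time `i` to time `j` (with `i < j`) is an f-walk from `v` to `v`: it
starts and ends at `v` and does not visit `v` in between. -/
def Walk.IsFSubwalk {G : RootedGraph.{u}} {n : ℕ} (w : G.Walk n) (v : G.V)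
    (i j : Fin (n + 1)) : Prop :=
  i < j ∧ w.vert i = v ∧ w.vert j = v ∧ ∀ k, i < k → k < j → w.vert k ≠ v

/-- The colors of consecutive edges of the walk are different. -/
def Walk.IsAlternating {G : RootedGraph.{u}} {n : ℕ} (w : G.Walk n) (c : G.E → Color) : Prop :=
  ∀ i j : Fin n, (j : ℕ) = i + 1 → c (w.edge i) ≠ c (w.edge j)

/-- The set `Dₙ(v)` of alternating d-walks of length `n` from `v` to `v`: alternating walks whose
first edge has color `1` and which are a pair `(u₁, u₂)` of f-walks from `v` to `v`. -/
def alternatingDWalks (G : RootedGraph.{u}) (c : G.E → Color) (v : G.V) (n : ℕ) :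
    Set (G.Walk n) :=
  {w | w.IsAlternating c ∧ (∀ i : Fin n, (i : ℕ) = 0 → c (w.edge i) = Color.one) ∧
    ∃ k, w.IsFSubwalk v 0 k ∧ w.IsFSubwalk v k (Fin.last n)}

end RootedGraph

/-! ### The free product of rooted graphs -/

section FreeProduct

variable (G : Color → RootedGraph.{u})

/-- The free product of the rooted vertex sets: words `x₁ x₂ ⋯ xₘ` (`m ≥ 0`) whose letters are
vertices other than the roots, with neighbouring letters from different graphs. The empty word
is the root. -/
def Word : Type u :=
  {w : List (Σ i, {x : (G i).V // x ≠ (G i).root}) // w.IsChain (fun a b => a.1 ≠ b.1)}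

/-- The words at which a copy of `G i` is attached by its root: those whose first letter is not
a vertex of `G i`. -/
def AttachingWord (i : Color) : Type u :=
  {u : Word G // ∀ a ∈ u.1.head?, a.1 ≠ i}

open Classical in
/-- The vertex `x u` of the free product that corresponds to the vertex `x` in the copy of `G i`
attached at `u`; the root of that copy is `u` itself. -/
noncomputable def place (i : Color) (u : AttachingWord G i) (x : (G i).V) : Word G :=
  if h : x = (G i).root then u.1
  else ⟨⟨i, x, h⟩ :: u.1.1, List.isChain_cons.2 ⟨fun a ha => (u.2 a ha).symm, u.1.2⟩⟩

/-- The free product `𝒢₁ * 𝒢₂` of rooted graphs: for every color `i` and every word `u` not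
beginning with a letter from `G i`, it contains a copy of `G i` with its root at `u`; an edge `β`
of `G i` with ends `x`, `y` gives an edge with ends `x u`, `y u`. -/
noncomputable def freeProduct : RootedGraph.{u} where
  V := Word G
  E := Σ i : Color, AttachingWord G i × (G i).E
  ends := fun β => ((G β.1).ends β.2.2).map (place G β.1 β.2.1)
  root := ⟨[], List.isChain_nil⟩

/-- The natural coloring: the edges of all copies of `G i` have color `i`. -/
def naturalColoring (β : (freeProduct G).E) : Color := β.1

/-- The adjacency operator `Sᵢ` of the subgraph of the free product formed by the edges of
color `i`. -/
noncomputable def monochromaticAdjacency (i : Color) :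
    ℓ²((freeProduct G).V, ℂ) →L[ℂ] ℓ²((freeProduct G).V, ℂ) :=
  ((freeProduct G).monochromatic (naturalColoring G) i).adjacencyOperator

end FreeProduct

end FreeMult

open FreeMult

universe u

/-!
Let `P` be the projection onto `δ(e)` and `Z = S₂ S₁`. The renewal equation between moments and
first return moments gives `N_Z(n) = φ_e((Z (1 - P)) ^ (n - 1) Z)`, which is the number of closed
walks of length `2 n` at `e` whose colors are `1, 2, 1, 2, …` and which avoid `e` at the even times
in between. In the free product an f-walk from `e` stays in one branch, hence its first and its last
edge have the same color and an alternating f-walk has odd length. Therefore such a walk, having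
even length, must return to `e`; it can only do so at odd times, and it cannot do so twice, because
two consecutive f-walks lead to an even time. These walks are thus the alternating d-walks.

Freeness holds because `Sᵢ` is the direct sum of copies of `A(𝒢ᵢ)`, one for each word `u` not
beginning with a letter from `Vᵢ`: a centered polynomial in `Sᵢ` maps a vector that vanishes at all
words beginning with a letter from `Vᵢ` to one that vanishes at all other words.
-/

namespace FreeMult

/-! ### Distributions and first return moments -/

section Distribution

variable {A B : Type*} [Ring A] [Algebra ℂ A] [Ring B] [Algebra ℂ B]

theorem UnitalFunctional.distribution_apply (φ : UnitalFunctional A) (a : A) (p : ℂ[X]) :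
    φ.distribution a p = φ (Polynomial.aeval a p) := rfl

theorem UnitalFunctional.distribution_X_pow (φ : UnitalFunctional A) (a : A) (n : ℕ) :
    φ.distribution a (Polynomial.X ^ n) = φ (a ^ n) := by
  rw [distribution_apply, map_pow, Polynomial.aeval_X]

/-- The pullback of a normalized functional along a unital homomorphism of algebras. -/
def UnitalFunctional.comap (φ : UnitalFunctional A) (f : B →ₐ[ℂ] A) : UnitalFunctional B where
  toLinearMap := φ.toLinearMap ∘ₗ f.toLinearMap
  map_one' := by simpa using φ.map_one'

theorem UnitalFunctional.comap_apply (φ : UnitalFunctional A) (f : B →ₐ[ℂ] A) (b : B) :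
    φ.comap f b = φ (f b) := rfl

theorem UnitalFunctional.distribution_comap (φ : UnitalFunctional A) (f : B →ₐ[ℂ] A) (b : B) :
    (φ.comap f).distribution b = φ.distribution (f b) := by
  refine UnitalFunctional.ext fun p => ?_
  rw [distribution_apply, comap_apply, distribution_apply, Polynomial.aeval_algHom_apply]

theorem FreelyIndependent.mono {φ : UnitalFunctional A} {C D : Color → Subalgebra ℂ A}
    (h : FreelyIndependent φ D) (hCD : ∀ i, C i ≤ D i) : FreelyIndependent φ C :=
  fun l hl hc hmem => h l hl hc fun p hp => ⟨hCD _ (hmem p hp).1, (hmem p hp).2⟩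

theorem FreelyIndependent.comap {φ : UnitalFunctional A} {C : Color → Subalgebra ℂ A}
    (h : FreelyIndependent φ C) (f : B →ₐ[ℂ] A) :
    FreelyIndependent (φ.comap f) fun i => (C i).comap f := by
  intro l hl hc hmem
  have hφ := h (l.map fun p => (p.1, f p.2)) (by simpa using hl) ((List.isChain_map _).2 hc)
    (by rw [List.forall_mem_map]; exact hmem)
  rw [List.map_map] at hφ
  rwa [UnitalFunctional.comap_apply, map_list_prod, List.map_map]

theorem IsFreeProduct.eq_freeProductFunctional {μ : Color → Distribution}
    {φ : UnitalFunctional (FreeAlgebra ℂ Color)} (hφ : IsFreeProduct μ φ) :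
    φ = freeProductFunctional μ :=
  (existsUnique_isFreeProduct μ).unique hφ (isFreeProduct_freeProductFunctional μ)

theorem freeMulConv_eq (μ : Color → Distribution) :
    freeMulConv (μ .one) (μ .two) = (freeProductFunctional μ).distribution
      (FreeAlgebra.ι ℂ Color.two * FreeAlgebra.ι ℂ Color.one) := by
  rw [freeMulConv]
  congr
  funext i
  cases i <;> rfl

theorem FreelyIndependent.isFreeProduct_comap_lift {φ : UnitalFunctional A} {a : Color → A}
    (h : FreelyIndependent φ fun i => Algebra.adjoin ℂ {a i}) :
    IsFreeProduct (fun i => φ.distribution (a i)) (φ.comap (FreeAlgebra.lift ℂ a)) := by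
  refine ⟨fun i => ?_, (h.comap (FreeAlgebra.lift ℂ a)).mono fun i => ?_⟩
  · rw [UnitalFunctional.distribution_comap, FreeAlgebra.lift_ι_apply]
  · rw [Algebra.adjoin_le_iff, Set.singleton_subset_iff, SetLike.mem_coe, Subalgebra.mem_comap,
      FreeAlgebra.lift_ι_apply]
    exact Algebra.self_mem_adjoin_singleton ℂ (a i)

theorem FreelyIndependent.distribution_mul {φ : UnitalFunctional A} {a : Color → A}
    (h : FreelyIndependent φ fun i => Algebra.adjoin ℂ {a i}) :
    φ.distribution (a .two * a .one) =
      freeMulConv (φ.distribution (a .one)) (φ.distribution (a .two)) := by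
  rw [freeMulConv_eq fun i => φ.distribution (a i),
    ← h.isFreeProduct_comap_lift.eq_freeProductFunctional, UnitalFunctional.distribution_comap,
    map_mul, FreeAlgebra.lift_ι_apply, FreeAlgebra.lift_ι_apply]

theorem adjoin_sub_one_le (a : A) : Algebra.adjoin ℂ {a - 1} ≤ Algebra.adjoin ℂ {a} := by
  rw [Algebra.adjoin_le_iff, Set.singleton_subset_iff]
  exact sub_mem (Algebra.self_mem_adjoin_singleton ℂ a) (one_mem _)

theorem one_add_momentSeries (μ : Distribution) :
    1 + momentSeries μ = PowerSeries.mk fun n => μ (Polynomial.X ^ n) := by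
  ext n
  rw [map_add, momentSeries, PowerSeries.coeff_mk, PowerSeries.coeff_mk, PowerSeries.coeff_one]
  rcases n with _ | n
  · simpa using μ.map_one'.symm
  · simp

theorem firstReturnMoment_succ_of_renewal {μ : Distribution} {d : ℕ → ℂ}
    (h : ∀ n, μ (Polynomial.X ^ (n + 1)) =
      ∑ p ∈ Finset.HasAntidiagonal.antidiagonal n, d p.1 * μ (Polynomial.X ^ p.2)) (n : ℕ) :
    firstReturnMoment μ (n + 1) = d n := by
  have hψ : momentSeries μ = PowerSeries.X * PowerSeries.mk d * (1 + momentSeries μ) := by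
    rw [one_add_momentSeries, mul_assoc]
    ext (_ | n)
    · simp [momentSeries]
    · rw [PowerSeries.coeff_succ_X_mul]
      simp [momentSeries, PowerSeries.coeff_mul, h]
  have hconst : PowerSeries.constantCoeff (1 + momentSeries μ) ≠ 0 := by simp [momentSeries]
  have hη : etaSeries μ = PowerSeries.X * PowerSeries.mk d :=
    calc etaSeries μ = PowerSeries.X * PowerSeries.mk d * (1 + momentSeries μ) *
          (1 + momentSeries μ)⁻¹ := congrArg (· * (1 + momentSeries μ)⁻¹) hψ
      _ = PowerSeries.X * PowerSeries.mk d := by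
        rw [mul_assoc, PowerSeries.mul_inv_cancel _ hconst, mul_one]
  rw [firstReturnMoment, hη, PowerSeries.coeff_succ_X_mul, PowerSeries.coeff_mk]

theorem pow_succ_eq_add_sum_antidiagonal {R : Type*} [Ring R] (x y : R) (n : ℕ) :
    x ^ (n + 1) = y ^ (n + 1) +
      ∑ p ∈ Finset.HasAntidiagonal.antidiagonal n, y ^ p.1 * (x - y) * x ^ p.2 := by
  induction n with
  | zero => simp
  | succ n ih =>
    have hshift : ∑ p ∈ Finset.HasAntidiagonal.antidiagonal n, y ^ (p.1 + 1) * (x - y) * x ^ p.2 =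
        y * (x ^ (n + 1) - y ^ (n + 1)) := by
      rw [ih, add_sub_cancel_left, Finset.mul_sum]
      simp only [pow_succ', mul_assoc]
    rw [Finset.Nat.sum_antidiagonal_succ, hshift]
    simp only [pow_zero, one_mul, sub_mul, mul_sub, ← pow_succ']
    abel

/-- If `p` is the rank one projection belonging to a vector state `φ`, the first return moments
of `x` are obtained by forbidding the state vector between consecutive factors `x`. -/
theorem firstReturnMoment_distribution_succ {φ : UnitalFunctional A} {p : A}
    (hp : ∀ a b, φ (a * p * b) = φ a * φ b) (x : A) (n : ℕ) :
    firstReturnMoment (φ.distribution x) (n + 1) = φ ((x * (1 - p)) ^ n * x) := by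
  have hφp : ∀ a, φ (a * p) = φ a := fun a => by simpa [φ.map_one'] using hp a 1
  refine firstReturnMoment_succ_of_renewal (d := fun n => φ ((x * (1 - p)) ^ n * x)) (fun n => ?_) n
  have hreturn : x - x * (1 - p) = x * p := by rw [mul_sub, mul_one, sub_sub_cancel]
  have hzero : φ ((x * (1 - p)) ^ (n + 1)) = 0 := by
    rw [pow_succ, ← mul_assoc, mul_sub, mul_one, map_sub, hφp, sub_self]
  rw [UnitalFunctional.distribution_X_pow, pow_succ_eq_add_sum_antidiagonal x (x * (1 - p)),
    map_add, hzero, zero_add, map_sum]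
  refine Finset.sum_congr rfl fun q _ => ?_
  rw [UnitalFunctional.distribution_X_pow, hreturn, ← mul_assoc, hp]

end Distribution

/-! ### Step operators and walks -/

namespace RootedGraph

variable {H : RootedGraph.{u}}

theorem delta_apply_self (x : H.V) : H.delta x x = 1 := by
  classical
  rw [delta, lp.single_apply_self]

theorem delta_apply_of_ne {x y : H.V} (h : y ≠ x) : H.delta x y = 0 := by
  classical
  rw [delta, lp.single_apply_ne _ _ _ h]

theorem orthonormal_delta (H : RootedGraph.{u}) : Orthonormal ℂ H.delta :=
  ⟨H.norm_delta, fun x _ h => (H.inner_delta_left x _).trans (delta_apply_of_ne h)⟩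

theorem continuousLinearMap_ext {E : Type*} [NormedAddCommGroup E] [NormedSpace ℂ E]
    {S T : ℓ²(H.V, ℂ) →L[ℂ] E} (h : ∀ x, S (H.delta x) = T (H.delta x)) : S = T := by
  classical
  refine lp.ext_continuousLinearMap ENNReal.ofNat_ne_top fun x => ContinuousLinearMap.ext_ring ?_
  exact h x

theorem finsum_mem_delta_apply {ι : Type*} {s : Set ι} (hs : s.Finite) (f : ι → H.V) (y : H.V) :
    (∑ᶠ i ∈ s, H.delta (f i)) y = ({i ∈ s | f i = y}.ncard : ℂ) := by
  classical
  rw [finsum_mem_eq_finite_toFinset_sum _ hs, lp.coeFn_sum, Finset.sum_apply,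
    Finset.sum_congr rfl fun i _ => (show H.delta (f i) y = if f i = y then 1 else 0 from ?_),
    Finset.sum_boole, Set.ncard_eq_toFinset_card _ (hs.subset fun _ hi => hi.1)]
  · congr 2
    ext i
    simp
  · split_ifs with h
    · rw [h, delta_apply_self]
    · rw [delta_apply_of_ne (Ne.symm h)]

theorem rootState_apply (T : ℓ²(H.V, ℂ) →L[ℂ] ℓ²(H.V, ℂ)) :
    H.rootState T = T (H.delta H.root) H.root :=
  inner_delta_left _ _ _

theorem measureDistribution_spectralDistribution (H : RootedGraph.{u}) :
    measureDistribution H.spectralDistribution = H.rootState.distribution H.adjacencyOperator := by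
  refine UnitalFunctional.ext fun p => ?_
  refine LinearMap.congr_fun (Module.Basis.ext (Polynomial.basisMonomials ℂ) fun n => ?_) p
  have hX : Polynomial.basisMonomials ℂ n = Polynomial.X ^ n := by
    rw [Polynomial.coe_basisMonomials, ← Polynomial.monomial_one_right_eq_X_pow]
  rw [measureDistribution, Module.Basis.constr_basis, hX, UnitalFunctional.distribution_X_pow]
  exact (H.isSpectralDistribution_spectralDistribution n).2.symm

/-- The orthogonal projection onto the line spanned by the vector `δ(e)` of the root. -/
noncomputable def rootProjection (H : RootedGraph.{u}) : ℓ²(H.V, ℂ) →L[ℂ] ℓ²(H.V, ℂ) :=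
  InnerProductSpace.rankOne ℂ (H.delta H.root) (H.delta H.root)

theorem rootProjection_apply (f : ℓ²(H.V, ℂ)) :
    H.rootProjection f = f H.root • H.delta H.root := by
  rw [rootProjection, InnerProductSpace.rankOne_apply, inner_delta_left]

theorem rootState_mul_rootProjection_mul (S T : ℓ²(H.V, ℂ) →L[ℂ] ℓ²(H.V, ℂ)) :
    H.rootState (S * H.rootProjection * T) = H.rootState S * H.rootState T := by
  rw [rootState_apply, rootState_apply, rootState_apply, mul_apply_eq_comp, mul_apply_eq_comp,
    rootProjection_apply, map_smul, lp.coeFn_smul, Pi.smul_apply, smul_eq_mul, mul_comm]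

theorem one_sub_rootProjection_delta_root :
    (1 - H.rootProjection) (H.delta H.root) = 0 := by
  rw [sub_apply, one_apply_eq_self, rootProjection_apply, delta_apply_self, one_smul, sub_self]

theorem one_sub_rootProjection_delta_of_ne {x : H.V} (h : x ≠ H.root) :
    (1 - H.rootProjection) (H.delta x) = H.delta x := by
  rw [sub_apply, one_apply_eq_self, rootProjection_apply, delta_apply_of_ne h.symm, zero_smul,
    sub_zero]

/-- The pairs `(β, y)` by which a walk at `x` can be continued along an edge `β` to a vertex `y`,
subject to the condition `R` on the vertex `x` and the edge `β`. -/
def steps (H : RootedGraph.{u}) (R : H.V → H.E → Prop) (x : H.V) : Set (H.E × H.V) :=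
  {p | H.ends p.1 = s(x, p.2) ∧ R x p.1}

theorem UniformlyLocallyFinite.finite_steps (hH : H.UniformlyLocallyFinite)
    (R : H.V → H.E → Prop) (x : H.V) : (H.steps R x).Finite := by
  obtain ⟨K, hK⟩ := hH
  refine Set.Finite.of_finite_image (f := Prod.fst)
    ((Set.finite_of_encard_le_coe (hK x)).subset ?_) ?_
  · rintro _ ⟨p, ⟨hp, -⟩, rfl⟩
    exact Sym2.mem_iff_exists.2 ⟨p.2, hp⟩
  · rintro ⟨β, y⟩ ⟨hy, -⟩ ⟨_, y'⟩ ⟨hy', -⟩ rfl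
    exact congrArg (Prod.mk β) (Sym2.congr_right.1 (hy.symm.trans hy'))

/-- `T` is the adjacency operator of the directed graph formed by the steps subject to `R`. -/
def IsStepOperator (H : RootedGraph.{u}) (T : ℓ²(H.V, ℂ) →L[ℂ] ℓ²(H.V, ℂ))
    (R : H.V → H.E → Prop) : Prop :=
  ∀ x, T (H.delta x) = ∑ᶠ p ∈ H.steps R x, H.delta p.2

theorem isStepOperator_adjacencyOperator (hH : H.UniformlyLocallyFinite) :
    H.IsStepOperator H.adjacencyOperator fun _ _ => True := by
  intro x
  ext y
  have himage : {p ∈ H.steps (fun _ _ => True) x | p.2 = y} =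
      (fun β => (β, y)) '' {β | H.ends β = s(x, y)} := by
    ext ⟨β, z⟩
    simp only [steps, and_true, Set.mem_ofPred_eq, Set.mem_image, Prod.mk.injEq]
    constructor
    · rintro ⟨h, rfl⟩
      exact ⟨β, h, rfl, rfl⟩
    · rintro ⟨_, h, rfl, rfl⟩
      exact ⟨h, rfl⟩
  rw [H.isAdjacencyOperator_adjacencyOperator hH, finsum_mem_delta_apply (hH.finite_steps _ x),
    himage, Set.ncard_image_of_injective _ (Prod.mk_left_injective y)]
  rfl

theorem UniformlyLocallyFinite.monochromatic (hH : H.UniformlyLocallyFinite)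
    (c : H.E → Color) (i : Color) : (H.monochromatic c i).UniformlyLocallyFinite := by
  obtain ⟨K, hK⟩ := hH
  refine ⟨K, fun x => le_trans ?_ (hK x)⟩
  have hsub : Subtype.val '' {β | x ∈ (H.monochromatic c i).ends β} ⊆ {β | x ∈ H.ends β} := by
    rintro _ ⟨β, hβ, rfl⟩
    exact hβ
  exact (Subtype.val_injective.encard_image _).symm.le.trans (Set.encard_le_encard hsub)

/-- The adjacency operator of the subgraph formed by the edges of color `i`, on the `ℓ²`-space
of the whole graph. -/
noncomputable def colorAdjacency (H : RootedGraph.{u}) (c : H.E → Color) (i : Color) :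
    ℓ²(H.V, ℂ) →L[ℂ] ℓ²(H.V, ℂ) :=
  (H.monochromatic c i).adjacencyOperator

theorem isStepOperator_colorAdjacency (hH : H.UniformlyLocallyFinite) (c : H.E → Color)
    (i : Color) : H.IsStepOperator (H.colorAdjacency c i) fun _ β => c β = i := by
  intro x
  refine (isStepOperator_adjacencyOperator (hH.monochromatic c i) x).trans
    (finsum_mem_eq_of_bijOn (Prod.map Subtype.val id) ⟨?_, ?_, ?_⟩ fun _ _ => rfl)
  · rintro ⟨⟨β, hβ⟩, y⟩ ⟨h, -⟩
    exact ⟨h, hβ⟩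
  · exact (Subtype.val_injective.prodMap Function.injective_id).injOn
  · rintro ⟨β, y⟩ ⟨h, hβ⟩
    exact ⟨(⟨β, hβ⟩, y), ⟨h, trivial⟩, rfl⟩

theorem adjacencyOperator_eq_colorAdjacency_add (hH : H.UniformlyLocallyFinite)
    (c : H.E → Color) :
    H.adjacencyOperator = H.colorAdjacency c .one + H.colorAdjacency c .two := by
  refine continuousLinearMap_ext fun x => ?_
  have hunion : H.steps (fun _ _ => True) x =
      H.steps (fun _ β => c β = .one) x ∪ H.steps (fun _ β => c β = .two) x := by
    ext p
    rcases hp : c p.1 <;> simp [steps, hp]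
  have hdisj : Disjoint (H.steps (fun _ β => c β = .one) x)
      (H.steps (fun _ β => c β = .two) x) := by
    rw [Set.disjoint_left]
    rintro p ⟨-, h₁⟩ ⟨-, h₂⟩
    exact Color.noConfusion (h₁.symm.trans h₂)
  rw [add_apply, isStepOperator_adjacencyOperator hH x, isStepOperator_colorAdjacency hH c .one x,
    isStepOperator_colorAdjacency hH c .two x, hunion,
    finsum_mem_union hdisj (hH.finite_steps _ x) (hH.finite_steps _ x)]

theorem IsStepOperator.mul_one_sub_rootProjection {T : ℓ²(H.V, ℂ) →L[ℂ] ℓ²(H.V, ℂ)}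
    {R : H.V → H.E → Prop} (hT : H.IsStepOperator T R) :
    H.IsStepOperator (T * (1 - H.rootProjection)) fun x β => R x β ∧ x ≠ H.root := by
  intro x
  by_cases hx : x = H.root
  · subst hx
    rw [mul_apply_eq_comp, one_sub_rootProjection_delta_root, map_zero]
    simp [steps]
  · rw [mul_apply_eq_comp, one_sub_rootProjection_delta_of_ne hx, hT x]
    simp [steps, hx]

theorem Walk.ext {n : ℕ} {w w' : H.Walk n} (hv : w.vert = w'.vert) (he : w.edge = w'.edge) :
    w = w' := by
  cases w
  cases w'
  simp_all

/-- The walk of length zero at `x`. -/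
def Walk.nil (x : H.V) : H.Walk 0 where
  vert := fun _ => x
  edge := Fin.elim0
  ends_edge := fun i => i.elim0

/-- The walk `w` without its last step. -/
def Walk.init {n : ℕ} (w : H.Walk (n + 1)) : H.Walk n where
  vert := fun i => w.vert i.castSucc
  edge := fun i => w.edge i.castSucc
  ends_edge := fun i => w.ends_edge i.castSucc

/-- The last edge of a walk together with the vertex at which the walk ends. -/
def Walk.lastStep {n : ℕ} (w : H.Walk (n + 1)) : H.E × H.V :=
  (w.edge (Fin.last n), w.vert (Fin.last (n + 1)))

/-- The walk `w` continued along the edge `β` to the vertex `y`. -/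
def Walk.snoc {n : ℕ} (w : H.Walk n) (β : H.E) (y : H.V)
    (h : H.ends β = s(w.vert (Fin.last n), y)) : H.Walk (n + 1) where
  vert := Fin.snoc (α := fun _ => H.V) w.vert y
  edge := Fin.snoc (α := fun _ => H.E) w.edge β
  ends_edge := Fin.lastCases
    (by rw [Fin.snoc_last, Fin.succ_last, Fin.snoc_last, Fin.snoc_castSucc, h])
    fun i => by
      rw [Fin.snoc_castSucc, Fin.succ_castSucc, Fin.snoc_castSucc, Fin.snoc_castSucc, w.ends_edge]

theorem Walk.bijOn_lastStep {n : ℕ} (R : H.V → H.E → Prop) (w : H.Walk n) :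
    Set.BijOn Walk.lastStep
      {w' | w'.init = w ∧ R (w.vert (Fin.last n)) (w'.edge (Fin.last n))}
      (H.steps R (w.vert (Fin.last n))) := by
  refine ⟨?_, ?_, ?_⟩
  · rintro w' ⟨rfl, hR⟩
    exact ⟨w'.ends_edge (Fin.last n), hR⟩
  · rintro w₁ ⟨h₁, -⟩ w₂ ⟨h₂, -⟩ h
    have hinit := h₁.trans h₂.symm
    refine Walk.ext (funext (Fin.lastCases ?_ fun i => ?_)) (funext (Fin.lastCases ?_ fun i => ?_))
    · exact congrArg Prod.snd h
    · exact congrFun (congrArg Walk.vert hinit) i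
    · exact congrArg Prod.fst h
    · exact congrFun (congrArg Walk.edge hinit) i
  · rintro ⟨β, y⟩ ⟨h, hR⟩
    refine ⟨w.snoc β y h, ⟨Walk.ext ?_ ?_, ?_⟩, Prod.ext ?_ ?_⟩
    · exact Fin.init_snoc (α := fun _ => H.V) y w.vert
    · exact Fin.init_snoc (α := fun _ => H.E) β w.edge
    · simpa [Walk.snoc] using hR
    · exact Fin.snoc_last (α := fun _ => H.E) β w.edge
    · exact Fin.snoc_last (α := fun _ => H.V) y w.vert

/-- The walks of length `n` from `x` whose `j`-th step satisfies the condition `R j`. -/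
def walksFrom (H : RootedGraph.{u}) (R : ℕ → H.V → H.E → Prop) (x : H.V) (n : ℕ) :
    Set (H.Walk n) :=
  {w | w.vert 0 = x ∧ ∀ j : Fin n, R j (w.vert j.castSucc) (w.edge j)}

theorem walksFrom_zero (R : ℕ → H.V → H.E → Prop) (x : H.V) :
    H.walksFrom R x 0 = {Walk.nil x} := by
  ext w
  constructor
  · rintro ⟨hx, -⟩
    refine Walk.ext (funext fun i => ?_) (Subsingleton.elim _ _)
    rw [Fin.fin_one_eq_zero i, hx]
    rfl
  · rintro rfl
    exact ⟨rfl, fun j => j.elim0⟩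

theorem walksFrom_succ (R : ℕ → H.V → H.E → Prop) (x : H.V) (n : ℕ) :
    H.walksFrom R x (n + 1) = ⋃ w ∈ H.walksFrom R x n,
      {w' | w'.init = w ∧ R n (w.vert (Fin.last n)) (w'.edge (Fin.last n))} := by
  ext w'
  rw [Set.mem_iUnion₂]
  constructor
  · rintro ⟨hx, hR⟩
    exact ⟨w'.init, ⟨hx, fun j => hR j.castSucc⟩, rfl, hR (Fin.last n)⟩
  · rintro ⟨_, ⟨hx, hR⟩, rfl, hlast⟩
    exact ⟨hx, Fin.lastCases hlast hR⟩

theorem finite_walksFrom (hH : H.UniformlyLocallyFinite) (R : ℕ → H.V → H.E → Prop) (x : H.V)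
    (n : ℕ) : (H.walksFrom R x n).Finite := by
  induction n with
  | zero => rw [walksFrom_zero]; exact Set.finite_singleton _
  | succ n ih =>
    rw [walksFrom_succ]
    exact ih.biUnion fun w _ => (Walk.bijOn_lastStep (R n) w).finite_iff_finite.2
      (hH.finite_steps _ _)

/-- The vector `T_{n - 1} ⋯ T₁ T₀ δ(x)`. -/
noncomputable def walkVector (H : RootedGraph.{u}) (T : ℕ → ℓ²(H.V, ℂ) →L[ℂ] ℓ²(H.V, ℂ))
    (x : H.V) : ℕ → ℓ²(H.V, ℂ)
  | 0 => H.delta x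
  | n + 1 => T n (H.walkVector T x n)

theorem walkVector_eq_finsum (hH : H.UniformlyLocallyFinite)
    {T : ℕ → ℓ²(H.V, ℂ) →L[ℂ] ℓ²(H.V, ℂ)} {R : ℕ → H.V → H.E → Prop}
    (hT : ∀ j, H.IsStepOperator (T j) (R j)) (x : H.V) (n : ℕ) :
    H.walkVector T x n = ∑ᶠ w ∈ H.walksFrom R x n, H.delta (w.vert (Fin.last n)) := by
  induction n with
  | zero =>
    rw [walksFrom_zero, finsum_mem_singleton]
    rfl
  | succ n ih =>
    have hfin := finite_walksFrom hH R x n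
    rw [walksFrom_succ, finsum_mem_biUnion ?_ hfin fun w _ =>
      (Walk.bijOn_lastStep (R n) w).finite_iff_finite.2 (hH.finite_steps _ _)]
    · rw [walkVector, ih, ← ContinuousLinearMap.coe_coe, ← LinearMap.toAddMonoidHom_coe,
        AddMonoidHom.map_finsum_mem _ _ hfin]
      refine finsum_mem_congr rfl fun w _ => (hT n _).trans ?_
      exact (finsum_mem_eq_of_bijOn _ (Walk.bijOn_lastStep (R n) w) fun _ _ => rfl).symm
    · intro w _ w' _ hne
      rw [Function.onFun, Set.disjoint_left]
      rintro v ⟨h, -⟩ ⟨h', -⟩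
      exact hne (h.symm.trans h')

theorem walkVector_apply (hH : H.UniformlyLocallyFinite)
    {T : ℕ → ℓ²(H.V, ℂ) →L[ℂ] ℓ²(H.V, ℂ)} {R : ℕ → H.V → H.E → Prop}
    (hT : ∀ j, H.IsStepOperator (T j) (R j)) (x y : H.V) (n : ℕ) :
    H.walkVector T x n y = ({w ∈ H.walksFrom R x n | w.vert (Fin.last n) = y}.ncard : ℂ) := by
  rw [walkVector_eq_finsum hH hT, finsum_mem_delta_apply (finite_walksFrom hH R x n)]

theorem Walk.exists_isFSubwalk {n : ℕ} (w : H.Walk n) {v : H.V} {i j : Fin (n + 1)} (hij : i < j)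
    (hi : w.vert i = v) (hj : w.vert j = v) : ∃ k ≤ j, w.IsFSubwalk v i k := by
  obtain ⟨k, hkj, ⟨hik, hk⟩, hmin⟩ :=
    exists_minimal_le_of_wellFoundedLT (fun k => i < k ∧ w.vert k = v) j ⟨hij, hj⟩
  refine ⟨k, hkj, hik, hi, hk, fun l hil hlk hl => ?_⟩
  exact absurd (hmin ⟨hil, hl⟩ hlk.le) (not_le.2 hlk)

end RootedGraph

/-- The alternating sequence `1, 2, 1, 2, …` of colors, indexed from `0`. -/
def alternatingColor (n : ℕ) : Color := if Even n then .one else .two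

theorem alternatingColor_eq_iff {m n : ℕ} :
    alternatingColor m = alternatingColor n ↔ (Even m ↔ Even n) := by
  unfold alternatingColor
  by_cases hm : Even m <;> by_cases hn : Even n <;> simp [hm, hn]

namespace RootedGraph

variable {H : RootedGraph.{u}}

theorem Walk.isAlternating_and_iff {n : ℕ} (w : H.Walk n) (c : H.E → Color) :
    (w.IsAlternating c ∧ ∀ i : Fin n, (i : ℕ) = 0 → c (w.edge i) = .one) ↔
      ∀ j : Fin n, c (w.edge j) = alternatingColor j := by
  have eq_of_ne_of_ne : ∀ {a b d : Color}, a ≠ b → a ≠ d → b = d := by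
    rintro (_ | _) (_ | _) (_ | _) <;> simp
  constructor
  · rintro ⟨halt, hone⟩ ⟨j, hj⟩
    induction j with
    | zero => exact hone _ rfl
    | succ j ih =>
      have hcolor := halt ⟨j, Nat.lt_of_succ_lt hj⟩ ⟨j + 1, hj⟩ rfl
      rw [ih] at hcolor
      refine eq_of_ne_of_ne hcolor ?_
      rw [Ne, alternatingColor_eq_iff, Nat.even_add_one]
      exact not_iff_self ∘ Iff.symm
  · refine fun h => ⟨fun i j hij => ?_, fun i hi => ?_⟩
    · rw [h, h, Ne, alternatingColor_eq_iff, hij, Nat.even_add_one]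
      exact not_iff_self ∘ Iff.symm
    · rw [h, hi]
      rfl

theorem Walk.exists_isFSubwalk_isFSubwalk_iff {n : ℕ} (hn : n ≠ 0) {w : H.Walk (2 * n)} {v : H.V}
    (hodd : ∀ i j, w.IsFSubwalk v i j → Odd ((i : ℕ) + j)) :
    (∃ k, w.IsFSubwalk v 0 k ∧ w.IsFSubwalk v k (Fin.last (2 * n))) ↔
      (w.vert 0 = v ∧ w.vert (Fin.last (2 * n)) = v) ∧
        ∀ j : Fin (2 * n), Even (j : ℕ) → (j : ℕ) ≠ 0 → w.vert j.castSucc ≠ v := by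
  constructor
  · rintro ⟨k, hk, hk'⟩
    refine ⟨⟨hk.2.1, hk'.2.2.1⟩, fun j hj hj0 => ?_⟩
    have hkodd : Odd (k : ℕ) := by simpa using hodd 0 k hk
    have hjk : j.castSucc ≠ k := by
      rintro rfl
      exact Nat.not_even_iff_odd.2 hkodd hj
    rcases hjk.lt_or_gt with h | h
    · exact hk.2.2.2 _ (Fin.pos_iff_ne_zero.2 fun h0 => hj0 (congrArg Fin.val h0)) h
    · exact hk'.2.2.2 _ h (Fin.castSucc_lt_last j)
  · rintro ⟨⟨h0, hlast⟩, havoid⟩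
    obtain ⟨k, -, hk⟩ := w.exists_isFSubwalk (Fin.lt_def.2 (by simp; omega)) h0 hlast
    have hkodd : Odd (k : ℕ) := by simpa using hodd 0 k hk
    have hklast : k < Fin.last (2 * n) := by
      refine (Fin.le_last k).lt_of_ne ?_
      rintro rfl
      exact Nat.not_even_iff_odd.2 hkodd (even_two_mul n)
    obtain ⟨l, -, hl⟩ := w.exists_isFSubwalk hklast hk.2.2.1 hlast
    have hleven : Even (l : ℕ) := (Nat.odd_add.1 (hodd k l hl)).1 hkodd
    obtain rfl : l = Fin.last (2 * n) := by
      by_contra hne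
      have hlt := (Fin.le_last l).lt_of_ne hne
      exact havoid (l.castLT hlt) hleven (Nat.ne_zero_of_lt hl.1) hl.2.2.1
    exact ⟨k, hk, hl⟩

/-- The condition on the `j`-th step of an alternating walk, with first edge of color `1`, that
does not visit the root at positive even times. -/
def IsEvenAvoidingStep (H : RootedGraph.{u}) (c : H.E → Color) (j : ℕ) (x : H.V) (β : H.E) :
    Prop :=
  c β = alternatingColor j ∧ (Even j → j ≠ 0 → x ≠ H.root)

open Classical in
/-- The operator that performs the `j`-th step of the walks subject to `IsEvenAvoidingStep`. -/
noncomputable def evenAvoidingOperator (H : RootedGraph.{u}) (c : H.E → Color) (j : ℕ) :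
    ℓ²(H.V, ℂ) →L[ℂ] ℓ²(H.V, ℂ) :=
  H.colorAdjacency c (alternatingColor j) * if Even j ∧ j ≠ 0 then 1 - H.rootProjection else 1

theorem isStepOperator_evenAvoidingOperator (hH : H.UniformlyLocallyFinite) (c : H.E → Color)
    (j : ℕ) : H.IsStepOperator (H.evenAvoidingOperator c j) (H.IsEvenAvoidingStep c j) := by
  have hS := isStepOperator_colorAdjacency hH c (alternatingColor j)
  rw [evenAvoidingOperator]
  split_ifs with hj
  · have hR : H.IsEvenAvoidingStep c j = fun x β => c β = alternatingColor j ∧ x ≠ H.root := by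
      funext x β
      exact propext ⟨fun h => ⟨h.1, h.2 hj.1 hj.2⟩, fun h => ⟨h.1, fun _ _ => h.2⟩⟩
    rw [hR]
    exact hS.mul_one_sub_rootProjection
  · have hR : H.IsEvenAvoidingStep c j = fun _ β => c β = alternatingColor j := by
      funext x β
      exact propext ⟨And.left, fun h => ⟨h, fun he h0 => absurd ⟨he, h0⟩ hj⟩⟩
    rwa [mul_one, hR]

theorem walkVector_evenAvoidingOperator (c : H.E → Color) (x : H.V) (n : ℕ) :
    H.walkVector (H.evenAvoidingOperator c) x (2 * (n + 1)) =
      ((H.colorAdjacency c .two * H.colorAdjacency c .one * (1 - H.rootProjection)) ^ n *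
        (H.colorAdjacency c .two * H.colorAdjacency c .one)) (H.delta x) := by
  have hodd : ∀ k, H.evenAvoidingOperator c (2 * k + 1) = H.colorAdjacency c .two := fun k => by
    simp [evenAvoidingOperator, alternatingColor]
  have hzero : H.evenAvoidingOperator c 0 = H.colorAdjacency c .one := by
    simp [evenAvoidingOperator, alternatingColor]
  have heven : ∀ k, H.evenAvoidingOperator c (2 * (k + 1)) =
      H.colorAdjacency c .one * (1 - H.rootProjection) := fun k => by
    simp [evenAvoidingOperator, alternatingColor]
  induction n with
  | zero =>
    rw [pow_zero, one_mul, mul_apply_eq_comp, ← hzero, ← hodd 0]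
    rfl
  | succ n ih =>
    rw [pow_succ', mul_assoc, mul_apply_eq_comp, ← ih, mul_assoc, ← heven, ← hodd (n + 1),
      mul_apply_eq_comp]
    rfl

theorem rootState_pow_mul_eq_ncard (hH : H.UniformlyLocallyFinite) (c : H.E → Color) (n : ℕ) :
    H.rootState
        ((H.colorAdjacency c .two * H.colorAdjacency c .one * (1 - H.rootProjection)) ^ n *
          (H.colorAdjacency c .two * H.colorAdjacency c .one)) =
      ({w ∈ H.walksFrom (H.IsEvenAvoidingStep c) H.root (2 * (n + 1)) |
        w.vert (Fin.last _) = H.root}.ncard : ℂ) := by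
  rw [rootState_apply, ← walkVector_evenAvoidingOperator,
    walkVector_apply hH (isStepOperator_evenAvoidingOperator hH c)]

end RootedGraph

/-! ### Walks in the free product -/

section FreeProductWalks

variable {G : Color → RootedGraph.{u}}

/-- The list of letters of a vertex of the free product. -/
def letters (w : (freeProduct G).V) : List (Σ i, {x : (G i).V // x ≠ (G i).root}) :=
  (show Word G from w).1

theorem letters_injective : Function.Injective (letters (G := G)) :=
  Subtype.val_injective

/-- The word `x u`, that is `place G i u x`, regarded as a vertex of the graph `𝒢₁ * 𝒢₂`. -/
noncomputable def AttachingWord.vertex {i : Color} (u : AttachingWord G i) (x : (G i).V) :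
    (freeProduct G).V :=
  place G i u x

theorem AttachingWord.letters_vertex_root {i : Color} (u : AttachingWord G i) :
    letters (u.vertex (G i).root) = u.1.1 :=
  congrArg Subtype.val (dif_pos rfl)

theorem AttachingWord.letters_vertex_of_ne {i : Color} (u : AttachingWord G i) {x : (G i).V}
    (h : x ≠ (G i).root) : letters (u.vertex x) = ⟨i, x, h⟩ :: u.1.1 :=
  congrArg Subtype.val (dif_neg h)

theorem AttachingWord.ext_letters {i : Color} {u u' : AttachingWord G i} (h : u.1.1 = u'.1.1) :
    u = u' :=
  Subtype.ext (Subtype.ext h)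

theorem exists_vertex_root_eq {i : Color} {w : (freeProduct G).V}
    (h : ∀ a ∈ (letters w).head?, a.1 ≠ i) :
    ∃ u : AttachingWord G i, u.vertex (G i).root = w :=
  ⟨⟨w, h⟩, letters_injective (AttachingWord.letters_vertex_root _)⟩

theorem exists_vertex_eq (i : Color) (w : (freeProduct G).V) :
    ∃ (u : AttachingWord G i) (x : (G i).V), u.vertex x = w := by
  by_cases h : ∀ a ∈ (letters w).head?, a.1 ≠ i
  · obtain ⟨u, hu⟩ := exists_vertex_root_eq h
    exact ⟨u, (G i).root, hu⟩
  · obtain ⟨l, hl⟩ := w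
    rcases l with _ | ⟨⟨j, x, hx⟩, l⟩
    · simp [letters] at h
    · obtain rfl : j = i := by simpa [letters] using h
      refine ⟨⟨⟨l, hl.tail⟩, fun a ha => ((List.isChain_cons.1 hl).1 a ha).symm⟩, x, ?_⟩
      exact letters_injective (AttachingWord.letters_vertex_of_ne _ hx)

theorem AttachingWord.vertex_root_ne_vertex {i : Color} (u u' : AttachingWord G i) {x : (G i).V}
    (hx : x ≠ (G i).root) : u.vertex (G i).root ≠ u'.vertex x := by
  intro h
  have hl := congrArg letters h
  rw [u.letters_vertex_root, u'.letters_vertex_of_ne hx] at hl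
  exact u.2 ⟨i, x, hx⟩ (by rw [hl, List.head?_cons, Option.mem_some_iff]) rfl

theorem AttachingWord.vertex_injective {i : Color} {u u' : AttachingWord G i} {x x' : (G i).V}
    (h : u.vertex x = u'.vertex x') : u = u' ∧ x = x' := by
  have hl := congrArg letters h
  by_cases hx : x = (G i).root <;> by_cases hx' : x' = (G i).root
  · subst hx hx'
    rw [u.letters_vertex_root, u'.letters_vertex_root] at hl
    exact ⟨ext_letters hl, rfl⟩
  · subst hx
    exact absurd h (u.vertex_root_ne_vertex u' hx')
  · subst hx'
    exact absurd h.symm (u'.vertex_root_ne_vertex u hx)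
  · rw [u.letters_vertex_of_ne hx, u'.letters_vertex_of_ne hx', List.cons.injEq] at hl
    obtain ⟨hhead, htail⟩ := hl
    refine ⟨ext_letters htail, ?_⟩
    simpa using hhead

theorem AttachingWord.vertex_eq_root_iff {i : Color} (u : AttachingWord G i) (x : (G i).V) :
    u.vertex x = (freeProduct G).root ↔ u.1.1 = [] ∧ x = (G i).root := by
  have hroot : letters (freeProduct G).root = [] := rfl
  rw [← letters_injective.eq_iff, hroot]
  by_cases hx : x = (G i).root
  · subst hx
    rw [u.letters_vertex_root, and_iff_left rfl]
  · simp [u.letters_vertex_of_ne hx, hx]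

theorem freeProduct_ends_eq_iff {i : Color} (u u' : AttachingWord G i) (β : (G i).E)
    (x : (G i).V) (w : (freeProduct G).V) :
    (freeProduct G).ends ⟨i, u', β⟩ = s(u.vertex x, w) ↔
      u' = u ∧ ∃ y, w = u.vertex y ∧ (G i).ends β = s(x, y) := by
  change ((G i).ends β).map u'.vertex = _ ↔ _
  constructor
  · induction (G i).ends β using Sym2.ind with
    | _ a b =>
      rw [Sym2.map_mk, Sym2.eq_iff]
      rintro (⟨hx, rfl⟩ | ⟨rfl, hx⟩)
      · obtain ⟨rfl, rfl⟩ := AttachingWord.vertex_injective hx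
        exact ⟨rfl, b, rfl, rfl⟩
      · obtain ⟨rfl, rfl⟩ := AttachingWord.vertex_injective hx
        exact ⟨rfl, a, rfl, Sym2.eq_swap⟩
  · rintro ⟨rfl, y, rfl, h⟩
    rw [h, Sym2.map_mk]

theorem exists_vertex_of_ends_eq {β : (freeProduct G).E} {w w' : (freeProduct G).V}
    (h : (freeProduct G).ends β = s(w, w')) :
    ∃ (u : AttachingWord G (naturalColoring G β)) (x y : (G (naturalColoring G β)).V),
      w = u.vertex x ∧ w' = u.vertex y := by
  obtain ⟨i, u', β⟩ := β
  obtain ⟨u, x, rfl⟩ := exists_vertex_eq i w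
  obtain ⟨-, y, rfl, -⟩ := (freeProduct_ends_eq_iff u u' β x w').1 h
  exact ⟨u, x, y, rfl, rfl⟩

theorem uniformlyLocallyFinite_freeProduct (hG : ∀ i, (G i).UniformlyLocallyFinite) :
    (freeProduct G).UniformlyLocallyFinite := by
  choose K hK using hG
  refine ⟨K .one + K .two, fun w => ?_⟩
  choose u x hx using fun i => exists_vertex_eq i w
  let edgesAt (i : Color) : Set (freeProduct G).E :=
    (fun β => ⟨i, u i, β⟩) '' {β | x i ∈ (G i).ends β}
  have hcard : ∀ i, (edgesAt i).encard ≤ K i := fun i =>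
    (Set.encard_image_le _ _).trans (hK i (x i))
  have hsub : {β | w ∈ (freeProduct G).ends β} ⊆ edgesAt .one ∪ edgesAt .two := by
    rintro ⟨i, u', β⟩ hβ
    obtain ⟨w', hw'⟩ := Sym2.mem_iff_exists.1 hβ
    rw [← hx i] at hw'
    obtain ⟨rfl, y, -, h⟩ := (freeProduct_ends_eq_iff (u i) u' β (x i) w').1 hw'
    have hmem : ⟨i, u i, β⟩ ∈ edgesAt i := ⟨β, Sym2.mem_iff_exists.2 ⟨y, h⟩, rfl⟩
    cases i
    · exact Or.inl hmem
    · exact Or.inr hmem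
  calc (freeProduct G).degree w ≤ (edgesAt .one ∪ edgesAt .two).encard := Set.encard_le_encard hsub
    _ ≤ (edgesAt .one).encard + (edgesAt .two).encard := Set.encard_union_le _ _
    _ ≤ (K .one + K .two : ℕ) := by
      rw [Nat.cast_add]
      exact add_le_add (hcard _) (hcard _)

/-- The part of the free product that is reached from the root through the copy of `G i` attached
there: the nonempty words whose last letter comes from `G i`. -/
def branch (G : Color → RootedGraph.{u}) (i : Color) : Set (freeProduct G).V :=
  {w | ∃ a ∈ (letters w).getLast?, a.1 = i}

theorem AttachingWord.vertex_mem_branch_iff {i j : Color} (u : AttachingWord G j) (x : (G j).V) :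
    u.vertex x ∈ branch G i ↔
      (∃ a ∈ u.1.1.getLast?, a.1 = i) ∨ (u.1.1 = [] ∧ x ≠ (G j).root ∧ j = i) := by
  rw [branch, Set.mem_ofPred_eq]
  by_cases hx : x = (G j).root
  · subst hx
    simp [u.letters_vertex_root]
  · rw [u.letters_vertex_of_ne hx]
    rcases u.1.1 with _ | ⟨b, l⟩
    · simp [hx]
    · simp [List.getLast?_cons_cons]

theorem mem_branch_of_ends_eq_root {β : (freeProduct G).E} {w : (freeProduct G).V}
    (h : (freeProduct G).ends β = s((freeProduct G).root, w)) (hw : w ≠ (freeProduct G).root) :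
    w ∈ branch G (naturalColoring G β) := by
  obtain ⟨u, x, y, hx, rfl⟩ := exists_vertex_of_ends_eq h
  obtain ⟨hu, -⟩ := (u.vertex_eq_root_iff x).1 hx.symm
  rw [Ne, u.vertex_eq_root_iff] at hw
  rw [u.vertex_mem_branch_iff]
  exact Or.inr ⟨hu, fun hy => hw ⟨hu, hy⟩, rfl⟩

theorem mem_branch_of_ends_eq {i : Color} {β : (freeProduct G).E} {w w' : (freeProduct G).V}
    (h : (freeProduct G).ends β = s(w, w')) (hw : w ∈ branch G i)
    (hw' : w' ≠ (freeProduct G).root) : w' ∈ branch G i := by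
  obtain ⟨u, x, y, rfl, rfl⟩ := exists_vertex_of_ends_eq h
  rw [Ne, u.vertex_eq_root_iff] at hw'
  rw [u.vertex_mem_branch_iff] at hw ⊢
  rcases hw with hw | ⟨hu, -, hj⟩
  · exact Or.inl hw
  · exact Or.inr ⟨hu, fun hy => hw' ⟨hu, hy⟩, hj⟩

theorem naturalColoring_eq_of_mem_branch {i : Color} {β : (freeProduct G).E}
    {w : (freeProduct G).V} (h : (freeProduct G).ends β = s(w, (freeProduct G).root))
    (hw : w ∈ branch G i) : naturalColoring G β = i := by
  obtain ⟨u, x, y, rfl, hy⟩ := exists_vertex_of_ends_eq h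
  obtain ⟨hu, -⟩ := (u.vertex_eq_root_iff y).1 hy.symm
  rcases (u.vertex_mem_branch_iff x).1 hw with ⟨a, ha, -⟩ | ⟨-, -, hi⟩
  · rw [hu, List.getLast?_nil] at ha
    exact absurd ha (Option.not_mem_none a)
  · exact hi

namespace RootedGraph.Walk

variable {n : ℕ} {w : (freeProduct G).Walk n}

theorem vert_mem_branch {i : Fin n} {k : Fin (n + 1)}
    (h : w.IsFSubwalk (freeProduct G).root i.castSucc k) (m : Fin (n + 1)) :
    i.castSucc < m → m < k → w.vert m ∈ branch G (naturalColoring G (w.edge i)) := by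
  obtain ⟨-, hi, -, havoid⟩ := h
  induction m using Fin.induction with
  | zero => exact fun him => absurd him (Fin.not_lt_zero _)
  | succ m ih =>
    intro him hmk
    have hends := w.ends_edge m
    rcases (Fin.le_castSucc_iff.2 him).eq_or_lt with heq | hlt
    · obtain rfl := Fin.castSucc_injective n heq
      rw [hi] at hends
      exact mem_branch_of_ends_eq_root hends (havoid _ him hmk)
    · exact mem_branch_of_ends_eq hends (ih hlt (m.castSucc_lt_succ.trans hmk)) (havoid _ him hmk)

/-- An f-walk from the root stays in one branch, which it enters and leaves by edges of its
color. -/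
theorem IsFSubwalk.naturalColoring_eq {i j : Fin n}
    (h : w.IsFSubwalk (freeProduct G).root i.castSucc j.succ) :
    naturalColoring G (w.edge j) = naturalColoring G (w.edge i) := by
  rcases (Fin.le_castSucc_iff.2 h.1).eq_or_lt with heq | hlt
  · rw [Fin.castSucc_injective n heq]
  · have hends := w.ends_edge j
    rw [h.2.2.1] at hends
    exact naturalColoring_eq_of_mem_branch hends (vert_mem_branch h _ hlt j.castSucc_lt_succ)

theorem IsFSubwalk.odd_add {i j : Fin (n + 1)} (h : w.IsFSubwalk (freeProduct G).root i j)
    (hw : ∀ k : Fin n, naturalColoring G (w.edge k) = alternatingColor k) :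
    Odd ((i : ℕ) + j) := by
  obtain ⟨i, rfl⟩ := Fin.exists_castSucc_eq.2 (Fin.ne_last_of_lt h.1)
  obtain ⟨j, rfl⟩ := Fin.exists_succ_eq.2 (Fin.ne_zero_of_lt h.1)
  have hcolor := h.naturalColoring_eq
  rw [hw, hw, alternatingColor_eq_iff] at hcolor
  rw [Fin.val_castSucc, Fin.val_succ, ← add_assoc, ← Nat.not_even_iff_odd, Nat.even_add_one,
    not_not, Nat.even_add]
  exact hcolor.symm

end RootedGraph.Walk

theorem alternatingDWalks_freeProduct {n : ℕ} (hn : n ≠ 0) :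
    (freeProduct G).alternatingDWalks (naturalColoring G) (freeProduct G).root (2 * n) =
      {w ∈ (freeProduct G).walksFrom ((freeProduct G).IsEvenAvoidingStep (naturalColoring G))
          (freeProduct G).root (2 * n) | w.vert (Fin.last _) = (freeProduct G).root} := by
  ext w
  rw [RootedGraph.alternatingDWalks, Set.mem_ofPred_eq, ← and_assoc, w.isAlternating_and_iff]
  have hfsub (hw : ∀ j, naturalColoring G (w.edge j) = alternatingColor j) :=
    RootedGraph.Walk.exists_isFSubwalk_isFSubwalk_iff hn (w := w) fun _ _ h => h.odd_add hw
  constructor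
  · rintro ⟨hw, hk⟩
    obtain ⟨⟨hstart, hend⟩, havoid⟩ := (hfsub hw).1 hk
    exact ⟨⟨hstart, fun j => ⟨hw j, havoid j⟩⟩, hend⟩
  · rintro ⟨⟨hstart, hstep⟩, hend⟩
    have hw := fun j => (hstep j).1
    exact ⟨hw, (hfsub hw).2 ⟨⟨hstart, hend⟩, fun j => (hstep j).2⟩⟩

end FreeProductWalks

/-! ### Freeness of the monochromatic adjacency operators -/

section Freeness

variable {G : Color → RootedGraph.{u}}

theorem AttachingWord.orthonormal_delta_vertex {i : Color} (u : AttachingWord G i) :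
    Orthonormal ℂ fun x => (freeProduct G).delta (u.vertex x) :=
  (freeProduct G).orthonormal_delta.comp u.vertex fun _ _ h => (vertex_injective h).2

/-- The isometric embedding `δ(x) ↦ δ(x u)` of `ℓ²(V_i)` onto the functions supported by the copy
of `G i` attached at `u`. -/
noncomputable def AttachingWord.embedding {i : Color} (u : AttachingWord G i) :
    ℓ²((G i).V, ℂ) →L[ℂ] ℓ²((freeProduct G).V, ℂ) :=
  u.orthonormal_delta_vertex.orthogonalFamily.linearIsometry.toContinuousLinearMap

theorem AttachingWord.embedding_delta {i : Color} (u : AttachingWord G i) (x : (G i).V) :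
    u.embedding ((G i).delta x) = (freeProduct G).delta (u.vertex x) := by
  classical
  refine (u.orthonormal_delta_vertex.orthogonalFamily.linearIsometry_apply_single _).trans ?_
  exact one_smul ℂ _

theorem AttachingWord.adjoint_embedding_apply {i : Color} (u : AttachingWord G i)
    (f : ℓ²((freeProduct G).V, ℂ)) (x : (G i).V) :
    ContinuousLinearMap.adjoint u.embedding f x = f (u.vertex x) := by
  rw [← RootedGraph.inner_delta_left, ContinuousLinearMap.adjoint_inner_right, u.embedding_delta,
    RootedGraph.inner_delta_left]

theorem AttachingWord.bijOn_steps {i : Color} (u : AttachingWord G i) (x : (G i).V) :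
    Set.BijOn (fun p : (G i).E × (G i).V => ((⟨i, u, p.1⟩, u.vertex p.2) :
        (freeProduct G).E × (freeProduct G).V))
      ((G i).steps (fun _ _ => True) x)
      ((freeProduct G).steps (fun _ β => naturalColoring G β = i) (u.vertex x)) := by
  refine ⟨?_, ?_, ?_⟩
  · rintro ⟨β, y⟩ ⟨h, -⟩
    exact ⟨(freeProduct_ends_eq_iff u u β x _).2 ⟨rfl, y, rfl, h⟩, rfl⟩
  · rintro ⟨β, y⟩ - ⟨β', y'⟩ - h
    obtain ⟨hβ, hy⟩ := Prod.ext_iff.1 h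
    cases hβ
    exact congrArg (Prod.mk β) (vertex_injective hy).2
  · rintro ⟨⟨i, u', β⟩, w⟩ ⟨h, rfl⟩
    obtain ⟨rfl, y, hw, hy⟩ := (freeProduct_ends_eq_iff u u' β x w).1 h
    exact ⟨(β, y), ⟨hy, trivial⟩, Prod.ext rfl hw.symm⟩

theorem monochromaticAdjacency_comp_embedding (hG : ∀ i, (G i).UniformlyLocallyFinite)
    {i : Color} (u : AttachingWord G i) :
    monochromaticAdjacency G i ∘L u.embedding = u.embedding ∘L (G i).adjacencyOperator := by
  refine RootedGraph.continuousLinearMap_ext fun x => ?_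
  have hS := RootedGraph.isStepOperator_colorAdjacency (uniformlyLocallyFinite_freeProduct hG)
    (naturalColoring G) i (u.vertex x)
  calc monochromaticAdjacency G i (u.embedding ((G i).delta x))
      = ∑ᶠ p ∈ (G i).steps (fun _ _ => True) x, u.embedding ((G i).delta p.2) := by
        rw [u.embedding_delta]
        refine hS.trans (finsum_mem_eq_of_bijOn _ (u.bijOn_steps x) fun p _ => ?_).symm
        exact u.embedding_delta p.2
    _ = u.embedding (∑ᶠ p ∈ (G i).steps (fun _ _ => True) x, (G i).delta p.2) :=
        (AddMonoidHom.map_finsum_mem _ u.embedding.toLinearMap.toAddMonoidHom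
          ((hG i).finite_steps _ x)).symm
    _ = u.embedding ((G i).adjacencyOperator ((G i).delta x)) := by
        rw [RootedGraph.isStepOperator_adjacencyOperator (hG i) x]

theorem adjoint_embedding_monochromaticAdjacency (hG : ∀ i, (G i).UniformlyLocallyFinite)
    {i : Color} (u : AttachingWord G i) (f : ℓ²((freeProduct G).V, ℂ)) :
    ContinuousLinearMap.adjoint u.embedding (monochromaticAdjacency G i f) =
      (G i).adjacencyOperator (ContinuousLinearMap.adjoint u.embedding f) := by
  have hS : ContinuousLinearMap.adjoint (monochromaticAdjacency G i) =
      monochromaticAdjacency G i :=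
    ((freeProduct G).monochromatic (naturalColoring G)
      i).isSelfAdjoint_adjacencyOperator.adjoint_eq
  have h := congrArg ContinuousLinearMap.adjoint (monochromaticAdjacency_comp_embedding hG u)
  rw [ContinuousLinearMap.adjoint_comp, ContinuousLinearMap.adjoint_comp, hS,
    (G i).isSelfAdjoint_adjacencyOperator.adjoint_eq] at h
  exact DFunLike.congr_fun h f

theorem adjoint_embedding_aeval (hG : ∀ i, (G i).UniformlyLocallyFinite) {i : Color}
    (u : AttachingWord G i) (p : ℂ[X]) (f : ℓ²((freeProduct G).V, ℂ)) :
    ContinuousLinearMap.adjoint u.embedding (Polynomial.aeval (monochromaticAdjacency G i) p f) =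
      Polynomial.aeval (G i).adjacencyOperator p (ContinuousLinearMap.adjoint u.embedding f) := by
  induction p using Polynomial.induction_on generalizing f with
  | C a => simp [Algebra.algebraMap_eq_smul_one]
  | add p q hp hq => rw [map_add, map_add, add_apply, add_apply, map_add, hp, hq]
  | monomial n a ih =>
    rw [pow_succ, ← mul_assoc, map_mul _ (_ * _), map_mul _ (_ * _), mul_apply_eq_comp,
      mul_apply_eq_comp, ih, Polynomial.aeval_X, Polynomial.aeval_X,
      adjoint_embedding_monochromaticAdjacency hG]

theorem aeval_monochromaticAdjacency_apply (hG : ∀ i, (G i).UniformlyLocallyFinite) {i : Color}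
    (u : AttachingWord G i) (p : ℂ[X]) {f : ℓ²((freeProduct G).V, ℂ)}
    (hf : ∀ x ≠ (G i).root, f (u.vertex x) = 0) :
    Polynomial.aeval (monochromaticAdjacency G i) p f (u.vertex (G i).root) =
      f (u.vertex (G i).root) * (G i).rootState.distribution (G i).adjacencyOperator p := by
  have hrestrict : ContinuousLinearMap.adjoint u.embedding f =
      f (u.vertex (G i).root) • (G i).delta (G i).root := by
    ext x
    rw [u.adjoint_embedding_apply, lp.coeFn_smul, Pi.smul_apply, smul_eq_mul]
    by_cases hx : x = (G i).root
    · rw [hx, RootedGraph.delta_apply_self, mul_one]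
    · rw [hf x hx, RootedGraph.delta_apply_of_ne hx, mul_zero]
  rw [← u.adjoint_embedding_apply, adjoint_embedding_aeval hG, hrestrict, map_smul, lp.coeFn_smul,
    Pi.smul_apply, smul_eq_mul, UnitalFunctional.distribution_apply, RootedGraph.rootState_apply]

theorem delta_root_apply_vertex {i : Color} (u : AttachingWord G i) {x : (G i).V}
    (hx : x ≠ (G i).root) : (freeProduct G).delta (freeProduct G).root (u.vertex x) = 0 :=
  RootedGraph.delta_apply_of_ne fun h => hx ((u.vertex_eq_root_iff x).1 h).2

theorem exists_vertex_root_eq_root (i : Color) :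
    ∃ u : AttachingWord G i, u.vertex (G i).root = (freeProduct G).root :=
  exists_vertex_root_eq fun _ ha => absurd ha (Option.not_mem_none _)

theorem distribution_monochromaticAdjacency (hG : ∀ i, (G i).UniformlyLocallyFinite) (i : Color) :
    (freeProduct G).rootState.distribution (monochromaticAdjacency G i) =
      (G i).rootState.distribution (G i).adjacencyOperator := by
  refine UnitalFunctional.ext fun p => ?_
  obtain ⟨u, hu⟩ := exists_vertex_root_eq_root (G := G) i
  have h := aeval_monochromaticAdjacency_apply hG u p fun x hx => delta_root_apply_vertex u hx
  rwa [hu, RootedGraph.delta_apply_self, one_mul, ← RootedGraph.rootState_apply] at h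

theorem apply_vertex_root_eq_zero (hG : ∀ i, (G i).UniformlyLocallyFinite) {i : Color}
    {T : ℓ²((freeProduct G).V, ℂ) →L[ℂ] ℓ²((freeProduct G).V, ℂ)}
    (hT : T ∈ Algebra.adjoin ℂ {monochromaticAdjacency G i}) (hφ : (freeProduct G).rootState T = 0)
    {f : ℓ²((freeProduct G).V, ℂ)} (u : AttachingWord G i)
    (hf : ∀ x ≠ (G i).root, f (u.vertex x) = 0) : T f (u.vertex (G i).root) = 0 := by
  rw [Algebra.adjoin_singleton_eq_range_aeval] at hT
  obtain ⟨p, rfl⟩ := hT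
  refine (aeval_monochromaticAdjacency_apply hG u p hf).trans ?_
  rw [← distribution_monochromaticAdjacency hG, UnitalFunctional.distribution_apply]
  exact mul_eq_zero_of_right _ hφ

theorem centered_prod_apply_vertex (hG : ∀ i, (G i).UniformlyLocallyFinite)
    {l : List (Color × (ℓ²((freeProduct G).V, ℂ) →L[ℂ] ℓ²((freeProduct G).V, ℂ)))}
    (hl : l.IsChain fun p q => p.1 ≠ q.1)
    (hmem : ∀ p ∈ l, p.2 ∈ Algebra.adjoin ℂ {monochromaticAdjacency G p.1} ∧
      (freeProduct G).rootState p.2 = 0) {j : Color} (hj : ∀ p ∈ l.head?, j ≠ p.1)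
    (u : AttachingWord G j) {x : (G j).V} (hx : x ≠ (G j).root) :
    (l.map Prod.snd).prod ((freeProduct G).delta (freeProduct G).root) (u.vertex x) = 0 := by
  induction l generalizing j x with
  | nil => exact delta_root_apply_vertex u hx
  | cons p l ih =>
    obtain ⟨i, T⟩ := p
    obtain ⟨hi, hl⟩ := List.isChain_cons.1 hl
    obtain ⟨⟨hT, hφ⟩, hmem⟩ := List.forall_mem_cons.1 hmem
    have hji : j ≠ i := hj _ rfl
    obtain ⟨u', hu'⟩ : ∃ u' : AttachingWord G i, u'.vertex (G i).root = u.vertex x := by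
      refine exists_vertex_root_eq ?_
      rw [u.letters_vertex_of_ne hx]
      rintro _ ⟨⟩
      exact hji
    rw [← hu', List.map_cons, List.prod_cons, mul_apply_eq_comp]
    exact apply_vertex_root_eq_zero hG hT hφ u' fun y hy => ih hl hmem hi u' hy

theorem freelyIndependent_monochromaticAdjacency (hG : ∀ i, (G i).UniformlyLocallyFinite) :
    FreelyIndependent (freeProduct G).rootState fun i =>
      Algebra.adjoin ℂ {monochromaticAdjacency G i} := by
  rintro (_ | ⟨⟨i, T⟩, l⟩) hne hl hmem
  · exact absurd rfl hne
  obtain ⟨hi, hl⟩ := List.isChain_cons.1 hl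
  obtain ⟨⟨hT, hφ⟩, hmem⟩ := List.forall_mem_cons.1 hmem
  obtain ⟨u, hu⟩ := exists_vertex_root_eq_root (G := G) i
  rw [List.map_cons, List.prod_cons, RootedGraph.rootState_apply, mul_apply_eq_comp]
  refine (congrArg _ hu.symm).trans (apply_vertex_root_eq_zero hG hT hφ u fun x hx => ?_)
  exact centered_prod_apply_vertex hG hl hmem hi u hx

theorem firstReturnMoment_monochromaticAdjacency_mul (hG : ∀ i, (G i).UniformlyLocallyFinite)
    {n : ℕ} (hn : n ≠ 0) :
    firstReturnMoment ((freeProduct G).rootState.distribution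
        (monochromaticAdjacency G .two * monochromaticAdjacency G .one)) n =
      (((freeProduct G).alternatingDWalks (naturalColoring G) (freeProduct G).root
        (2 * n)).ncard : ℂ) := by
  obtain ⟨n, rfl⟩ := Nat.exists_eq_succ_of_ne_zero hn
  rw [firstReturnMoment_distribution_succ RootedGraph.rootState_mul_rootProjection_mul,
    alternatingDWalks_freeProduct hn]
  exact RootedGraph.rootState_pow_mul_eq_ncard (uniformlyLocallyFinite_freeProduct hG) _ n

theorem finite_alternatingDWalks_freeProduct (hG : ∀ i, (G i).UniformlyLocallyFinite) {n : ℕ}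
    (hn : n ≠ 0) : ((freeProduct G).alternatingDWalks (naturalColoring G) (freeProduct G).root
      (2 * n)).Finite := by
  rw [alternatingDWalks_freeProduct hn]
  exact (RootedGraph.finite_walksFrom (uniformlyLocallyFinite_freeProduct hG) _ _ _).subset
    (Set.sep_subset _ _)

end Freeness

end FreeMult

theorem theorem9p2 (G : Color → RootedGraph.{u}) (hG : ∀ i, (G i).UniformlyLocallyFinite) :
    (freeProduct G).UniformlyLocallyFinite ∧
    (freeProduct G).adjacencyOperator =
      monochromaticAdjacency G .one + monochromaticAdjacency G .two ∧
    FreelyIndependent (freeProduct G).rootState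
      (fun i => Algebra.adjoin ℂ {monochromaticAdjacency G i - 1}) ∧
    ∀ n : ℕ, 1 ≤ n →
      firstReturnMoment ((freeProduct G).rootState.distribution
          (monochromaticAdjacency G .two * monochromaticAdjacency G .one)) n =
        firstReturnMoment (freeMulConv (measureDistribution (G .one).spectralDistribution)
          (measureDistribution (G .two).spectralDistribution)) n ∧
      ((freeProduct G).alternatingDWalks (naturalColoring G) (freeProduct G).root (2 * n)).Finite ∧
      firstReturnMoment ((freeProduct G).rootState.distribution
          (monochromaticAdjacency G .two * monochromaticAdjacency G .one)) n =
        (((freeProduct G).alternatingDWalks (naturalColoring G) (freeProduct G).root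
          (2 * n)).ncard : ℂ) := by
  have hfree := freelyIndependent_monochromaticAdjacency hG
  have hadd := RootedGraph.adjacencyOperator_eq_colorAdjacency_add
    (uniformlyLocallyFinite_freeProduct hG) (naturalColoring G)
  refine ⟨uniformlyLocallyFinite_freeProduct hG, hadd,
    hfree.mono fun i => adjoin_sub_one_le _, fun n hn => ?_⟩
  have hn0 := Nat.one_le_iff_ne_zero.1 hn
  refine ⟨?_, finite_alternatingDWalks_freeProduct hG hn0,
    firstReturnMoment_monochromaticAdjacency_mul hG hn0⟩
  rw [hfree.distribution_mul, distribution_monochromaticAdjacency hG,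
    distribution_monochromaticAdjacency hG, RootedGraph.measureDistribution_spectralDistribution,
    RootedGraph.measureDistribution_spectralDistribution]
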